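/- All graphs are finite, simple and labelled. A bridge of a graph $G$ is an edge whose deletion increases the number of components; $\kappa(G)$ is the number of components of $G$, $e_0(G)$ the number of its bridges, $\tilde G$ the graph obtained from $G$ by removing all its bridges, and $\mathrm{frag}(G)$ the number of vertices remaining when a largest component of $G$ is removed. For a set $\mathcal A$ of graphs, $\mathcal A_n$ is the set of graphs in $\mathcal A$ with vertex set $[n]=\{1,\dots,n\}$. The set $\mathcal A$ is bridge-addable if for all $G\in\mathcal A$ and all vertices $u,v$ in different components of $G$ the graph $G+uv$ is in $\mathcal A$; it is bridge-alterable if it is bridge-addable and, for all $G\in\mathcal A$ and every bridge $e$ of $G$, the graph $G\setminus e$ is in $\mathcal A$. A weighting consists of reals $\lambda>0$ and $\nu>0$ and a value $f(H)\ge 0$ for each bridge-free graph $H$; the weight of a graph is $\tau(G)=f(\tilde G)\,\lambda^{e_0(G)}\,\nu^{\kappa(G)}$, and $\tau(\mathcal B)=\sum_{G\in\mathcal B}\tau(G)$ for a finite set $\mathcal B$ of graphs. When $\tau(\mathcal A_n)>0$, a random graph $R_n$ is $\tau$-weighted random from $\mathcal A_n$ if $\Pr(R_n=G)=\tau(G)/\tau(\mathcal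 A_n)$ for each $G\in\mathcal A_n$. Theorem. (a) Let $\mathcal A$ be bridge-alterable, let $(\lambda,\nu,f)$ be a weighting, and suppose that, for all sufficiently large $n$, $\tau(\mathcal A_n)>0$ and $R_n$ is $\tau$-weighted random from $\mathcal A_n$. Then $$\limsup_{n\to\infty}\mathbb E[\mathrm{frag}(R_n)]\le \frac{\nu}{\lambda}.$$ (b) In particular, if $\mathcal A$ is bridge-alterable and, for all sufficiently large $n$, $\mathcal A_n$ is non-empty and $R_n$ is uniformly distributed over $\mathcal A_n$, then $\limsup_{n\to\infty}\mathbb E[\mathrm{frag}(R_n)]\le 1$. (c) The bound $1$ in (b) is optimal: the set $\mathcal F$ of all forests is bridge-alterable, and if $R_n$ is uniformly distributed over $\mathcal F_n$ for all sufficiently large $n$, then $\mathbb E[\mathrm{frag}(R_n)]\to 1$ as $n\to\infty$. -/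

import Mathlib

open Filter Topology MeasureTheory

namespace RandomWeightedGraph

/-- The bridges of `G`. The predicate `SimpleGraph.IsBridge` does not by itself require `e` to be
an edge of `G`, so this is asked for separately. -/
def bridges {V : Type*} (G : SimpleGraph V) : Set (Sym2 V) :=
  {e | e ∈ G.edgeSet ∧ G.IsBridge e}

/-- The graph on the same vertices obtained from `G` by removing all its bridges. -/
def removeBridges {V : Type*} (G : SimpleGraph V) : SimpleGraph V :=
  G.deleteEdges (bridges G)

/-- `κ(G)`, the number of components of `G`. -/
noncomputable def numComponents {V : Type*} (G : SimpleGraph V) : ℕ :=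
  Nat.card G.ConnectedComponent

/-- `frag(G)`, the number of vertices left when a largest component of the finite graph `G`
is removed. -/
noncomputable def frag {V : Type*} (G : SimpleGraph V) : ℕ :=
  Nat.card V - ⨆ c : G.ConnectedComponent, c.supp.ncard

/-- A set of (labelled, finite) graphs, given through its members `A n` on the `n` vertices
`Fin n`, for each `n`. -/
abbrev GraphSet : Type := ∀ n : ℕ, Set (SimpleGraph (Fin n))

/-- Closed under adding an edge between vertices in different components. -/
def BridgeAddable (A : GraphSet) : Prop :=
  ∀ (n : ℕ), ∀ G ∈ A n, ∀ u v : Fin n, ¬ G.Reachable u v → G ⊔ SimpleGraph.edge u v ∈ A n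

/-- Bridge-addable and closed under deleting bridges. -/
def BridgeAlterable (A : GraphSet) : Prop :=
  BridgeAddable A ∧
    ∀ (n : ℕ), ∀ G ∈ A n, ∀ e ∈ bridges G, G.deleteEdges {e} ∈ A n

/-- The set of forests. -/
def forests : GraphSet := fun _ => {G | G.IsAcyclic}

/-- A weighting `(lam, nu, f)`: two positive reals, and a value `f G ≥ 0` for each bridge-free
graph `G` (values of `f` at other graphs are never used). -/
structure Weighting where
  lam : ℝ
  nu : ℝ
  f : ∀ n : ℕ, SimpleGraph (Fin n) → ℝ
  lam_pos : 0 < lam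
  nu_pos : 0 < nu
  f_nonneg : ∀ (n : ℕ) (G : SimpleGraph (Fin n)), bridges G = ∅ → 0 ≤ f n G

/-- The weight `τ(G) = f(G̃) λ^{e₀(G)} ν^{κ(G)}` of a graph. -/
noncomputable def Weighting.weight (τ : Weighting) {n : ℕ} (G : SimpleGraph (Fin n)) : ℝ :=
  τ.f n (removeBridges G) * τ.lam ^ (bridges G).ncard * τ.nu ^ numComponents G

open Classical in
/-- The total weight of a set of graphs on `Fin n`. -/
noncomputable def Weighting.total (τ : Weighting) {n : ℕ} (B : Set (SimpleGraph (Fin n))) : ℝ :=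
  ∑ G : SimpleGraph (Fin n) with G ∈ B, τ.weight G

/-- `R` is a `τ`-weighted random graph from the set `B` of graphs on `Fin n`, where `τ(B) > 0`:
`P(R = G) = τ(G) / τ(B)` for each `G ∈ B`. -/
structure IsWeightedRandom (τ : Weighting) {n : ℕ} (B : Set (SimpleGraph (Fin n)))
    {Ω : Type*} [MeasurableSpace Ω] (P : Measure Ω) (R : Ω → SimpleGraph (Fin n)) : Prop where
  measurable : Measurable R
  total_pos : 0 < τ.total B
  prob : ∀ G ∈ B, P.real {ω | R ω = G} = τ.weight G / τ.total B

/-- `R` is uniformly distributed over the non-empty set `B` of graphs on `Fin n`. -/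
structure IsUniformRandom {n : ℕ} (B : Set (SimpleGraph (Fin n)))
    {Ω : Type*} [MeasurableSpace Ω] (P : Measure Ω) (R : Ω → SimpleGraph (Fin n)) : Prop where
  measurable : Measurable R
  nonempty : B.Nonempty
  prob : ∀ G ∈ B, P.real {ω | R ω = G} = 1 / (B.ncard : ℝ)

/-- The expected value of `frag(R)`. -/
noncomputable def expectedFrag {n : ℕ} {Ω : Type*} [MeasurableSpace Ω] (P : Measure Ω)
    (R : Ω → SimpleGraph (Fin n)) : ℝ :=
  ∫ ω, (frag (R ω) : ℝ) ∂P

end RandomWeightedGraph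

/-!
For a bridgeless graph `H`, the graphs `G` whose bridgeless part is `H` form a *bridge class*. A
bridge-alterable set is a union of bridge classes (`BridgeAlterable.removeBridges_mem_iff`), and
inside a class the weight of `G` is proportional to `x ^ κ(G)`, where `x = ν / λ`
(`Weighting.weight_eq`). So it suffices to bound the mean of `frag` in one class, uniformly in `H`.

In a class, pairs of a graph and an edge joining two of its components correspond to pairs of a
graph and one of its bridges (`sum_cross_eq_sum_bridges`). The number of bridges is `m - κ(G)` with
`m = κ(H) ≤ n`, hence the mean number of cross edges is at most `x n`. At least `frag * (n - frag)`
cross edges leave a largest component, so `n E[frag] ≤ x n + E[frag ^ 2]`, and everything reduces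
to a uniform bound `E[frag ^ 2] = O(√n)`.

For this second moment, let `s_i` be the component sizes of `G`, let `e_j` be their elementary
symmetric functions, and put `h(G) = ∑ j ≥ 2, j! e_j / n ^ j`. If two components of a `k`-component
graph are merged with weight proportional to the sum of their sizes, the mean of `h` is multiplied
by exactly `(k - 2) / (k - 1)` (`sum_merge_excess`; the `e_j` are handled as the coefficients of
`∏ (1 + s_i X)`, and the sum with weights `j! / n ^ j` as a Laplace transform). The exchange of
cross edges and bridges then yields two recursions in `k`, for the sums over the graphs with `k`
components of `∏ s_i` and of `(∏ s_i) h`. The second is started at `H`, the only graph with `m`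
components, and the first is compared with the number of connected graphs; together they bound
the sum of `(∏ s_i) h` by `h(H) / (k - 2)!` times the number of connected graphs in the class
(`levelSum_sizeProd_mul_graphExcess_le`). Since `frag ^ 2 ≤ k ^ 3 (∏ s_i) h` (`frag_sq_le`) and
`h(H) ≤ 2 √n` (`excess_le`), the bound on the second moment follows.

For forests, with `x = 1`, all edges are bridges, so the mean number of cross edges equals
`n - E[κ] ≥ n - 1 - E[frag]`; as there are at most `n * frag` cross edges, this bounds `E[frag]`
from below by `(n - 1) / (n + 1)` (`le_sum_frag_forests`).
-/

namespace RandomWeightedGraph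

open Classical SimpleGraph

/-! ### Adding an edge between two components -/

section AddEdge

variable {V : Type*} {G : SimpleGraph V} {u v : V}

lemma reachable_sup_edge_iff {a b : V} :
    (G ⊔ edge u v).Reachable a b ↔ G.Reachable a b ∨ (G.Reachable a u ∧ G.Reachable v b) ∨
      (G.Reachable a v ∧ G.Reachable u b) := by
  constructor
  · rintro ⟨p⟩
    induction p with
    | nil => exact Or.inl (Reachable.refl _)
    | @cons a c b hac _ ih =>
      rw [sup_adj, edge_adj] at hac
      rcases hac with hac | ⟨⟨rfl, rfl⟩ | ⟨rfl, rfl⟩, -⟩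
      · have h := hac.reachable
        rcases ih with ih | ⟨h1, h2⟩ | ⟨h1, h2⟩
        · exact Or.inl (h.trans ih)
        · exact Or.inr (Or.inl ⟨h.trans h1, h2⟩)
        · exact Or.inr (Or.inr ⟨h.trans h1, h2⟩)
      · rcases ih with ih | ⟨h1, h2⟩ | ⟨h1, h2⟩
        · exact Or.inr (Or.inl ⟨Reachable.refl _, ih⟩)
        · exact Or.inr (Or.inl ⟨Reachable.refl _, h2⟩)
        · exact Or.inl h2
      · rcases ih with ih | ⟨h1, h2⟩ | ⟨h1, h2⟩
        · exact Or.inr (Or.inr ⟨Reachable.refl _, ih⟩)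
        · exact Or.inl h2
        · exact Or.inr (Or.inr ⟨Reachable.refl _, h2⟩)
  · have hle : G ≤ G ⊔ edge u v := le_sup_left
    have huv : (G ⊔ edge u v).Reachable u v := by
      by_cases h : u = v
      · rw [h]
      · exact Adj.reachable (Or.inr ((edge_adj ..).2 ⟨Or.inl ⟨rfl, rfl⟩, h⟩))
    rintro (h | ⟨h1, h2⟩ | ⟨h1, h2⟩)
    · exact h.mono hle
    · exact (h1.mono hle).trans (huv.trans (h2.mono hle))
    · exact (h1.mono hle).trans (huv.symm.trans (h2.mono hle))

lemma ne_of_not_reachable (h : ¬ G.Reachable u v) : u ≠ v := by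
  rintro rfl; exact h (Reachable.refl _)

lemma edgeSet_sup_edge_of_not_reachable (h : ¬ G.Reachable u v) :
    (G ⊔ edge u v).edgeSet = insert s(u, v) G.edgeSet := by
  ext e
  induction e with | h a b =>
  have := ne_of_not_reachable h
  simp only [mem_edgeSet, sup_adj, edge_adj, Set.mem_insert_iff, Sym2.eq_iff]
  grind

lemma deleteEdges_sup_edge (h : ¬ G.Reachable u v) :
    (G ⊔ edge u v).deleteEdges {s(u, v)} = G := by
  have h' : s(u, v) ∉ G.edgeSet := fun h' => h (Adj.reachable h')
  rw [← edgeSet_inj, edgeSet_deleteEdges, edgeSet_sup_edge_of_not_reachable h]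
  simp [h']

lemma bridges_sup_edge (h : ¬ G.Reachable u v) :
    bridges (G ⊔ edge u v) = insert s(u, v) (bridges G) := by
  ext e
  simp only [bridges, edgeSet_sup_edge_of_not_reachable h, Set.mem_insert_iff, Set.mem_ofPred_eq]
  constructor
  · rintro ⟨rfl | he, hb⟩
    · exact Or.inl rfl
    · exact Or.inr ⟨he, hb.anti le_sup_left⟩
  · rintro (rfl | ⟨he, hb⟩)
    · exact ⟨Or.inl rfl, isBridge_sup_edge.2 (IsBridge.of_not_reachable h)⟩
    · exact ⟨Or.inr he, hb.sup_edge_of_not_reachable_of_isBridge h he⟩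

lemma mk_notMem_bridges (h : ¬ G.Reachable u v) : s(u, v) ∉ bridges G :=
  fun h' => h (Adj.reachable h'.1)

lemma removeBridges_sup_edge (h : ¬ G.Reachable u v) :
    removeBridges (G ⊔ edge u v) = removeBridges G := by
  have h' : s(u, v) ∉ G.edgeSet := fun h' => h (Adj.reachable h')
  rw [removeBridges, removeBridges, ← edgeSet_inj, edgeSet_deleteEdges, edgeSet_deleteEdges,
    edgeSet_sup_edge_of_not_reachable h, bridges_sup_edge h]
  ext e
  simp only [Set.mem_sdiff, Set.mem_insert_iff, not_or]
  grind

lemma not_reachable_deleteEdges (h : s(u, v) ∈ bridges G) :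
    ¬ (G.deleteEdges {s(u, v)}).Reachable u v := h.2

lemma deleteEdges_sup_edge_of_mem_bridges (h : s(u, v) ∈ bridges G) :
    G.deleteEdges {s(u, v)} ⊔ edge u v = G := by
  rw [← edgeSet_inj, edgeSet_sup_edge_of_not_reachable (not_reachable_deleteEdges h),
    edgeSet_deleteEdges, Set.insert_sdiff_singleton, Set.insert_eq_of_mem h.1]

/-- Induction on the number of bridges: a property of all bridgeless graphs that survives the
addition of an edge between two components holds for every finite graph. -/
lemma bridge_induction [Finite V] {p : SimpleGraph V → Prop}
    (base : ∀ G, bridges G = ∅ → p G)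
    (step : ∀ (G : SimpleGraph V) (u v : V), ¬ G.Reachable u v → p G → p (G ⊔ edge u v))
    (G : SimpleGraph V) : p G := by
  induction hk : (bridges G).ncard generalizing G with
  | zero => exact base G ((Set.ncard_eq_zero (Set.toFinite _)).1 hk)
  | succ k ih =>
    obtain ⟨e, he⟩ : (bridges G).Nonempty := by
      rw [← Set.ncard_pos (Set.toFinite _)]; omega
    induction e with | h u v =>
    have h1 := not_reachable_deleteEdges he
    have h2 := deleteEdges_sup_edge_of_mem_bridges he
    rw [← h2]
    refine step _ u v h1 (ih _ ?_)
    rw [← h2, bridges_sup_edge h1, Set.ncard_insert_of_notMem (mk_notMem_bridges h1)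
      (Set.toFinite _)] at hk
    omega

lemma bridges_removeBridges [Finite V] (G : SimpleGraph V) : bridges (removeBridges G) = ∅ := by
  induction G using bridge_induction with
  | base G h => simp [removeBridges, h]
  | step G u v h ih => rw [removeBridges_sup_edge h, ih]

lemma removeBridges_eq_self (h : bridges G = ∅) : removeBridges G = G := by
  simp [removeBridges, h]

end AddEdge

/-! ### Component sizes -/

section Components

variable {V : Type*} [Fintype V] {G : SimpleGraph V} {u v : V}

/-- One fixed enumeration of the components, so that no enumeration depends on how a graph is
written. -/
noncomputable instance componentFintype {V : Type*} [Finite V] (G : SimpleGraph V) :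
    Fintype G.ConnectedComponent := Fintype.ofFinite _

/-- The number of vertices of a component. -/
noncomputable def compSize (c : G.ConnectedComponent) : ℕ := c.supp.ncard

lemma compSize_eq_card (c : G.ConnectedComponent) :
    compSize c = (Finset.univ.filter fun w => G.connectedComponentMk w = c).card := by
  rw [compSize, Set.ncard_eq_toFinset_card']
  congr 1
  ext w
  simp

lemma one_le_compSize (c : G.ConnectedComponent) : 1 ≤ compSize c := by
  induction c using ConnectedComponent.ind with | h w =>
  rw [compSize_eq_card]
  exact Finset.card_pos.2 ⟨w, by simp⟩

lemma sum_comp_mk {M : Type*} [AddCommMonoid M] (F : G.ConnectedComponent → M) :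
    ∑ w, F (G.connectedComponentMk w) = ∑ c, compSize c • F c := by
  rw [← Finset.sum_fiberwise Finset.univ G.connectedComponentMk]
  refine Finset.sum_congr rfl fun c _ => ?_
  rw [compSize_eq_card, ← Finset.sum_const]
  exact Finset.sum_congr rfl fun w hw => by rw [(Finset.mem_filter.1 hw).2]

lemma sum_compSize (G : SimpleGraph V) :
    ∑ c : G.ConnectedComponent, compSize c = Fintype.card V := by
  have := sum_comp_mk (G := G) (fun _ => 1)
  simpa using this.symm

lemma numComponents_eq_card (G : SimpleGraph V) :
    numComponents G = Fintype.card G.ConnectedComponent := Nat.card_eq_fintype_card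

/-- How an edge between the components `c` and `d` changes a product over components of a function
of their sizes: the factors of `c` and `d` are replaced by one factor for their union. -/
lemma prod_compSize_sup_edge {M : Type*} [CommMonoid M] (φ : ℕ → M) (h : ¬ G.Reachable u v) :
    ∏ c : (G ⊔ edge u v).ConnectedComponent, φ (compSize c) =
      φ (compSize (G.connectedComponentMk u) + compSize (G.connectedComponentMk v)) *
        ∏ c ∈ (Finset.univ.erase (G.connectedComponentMk u)).erase (G.connectedComponentMk v),
          φ (compSize c) := by
  set U := G.connectedComponentMk u with hU
  set W := G.connectedComponentMk v with hW
  have hUW : U ≠ W := fun h' => h (ConnectedComponent.eq.1 h')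
  let π : G.ConnectedComponent → (G ⊔ edge u v).ConnectedComponent :=
    ConnectedComponent.map (Hom.ofLE le_sup_left)
  have hmk : ∀ w, π (G.connectedComponentMk w) = (G ⊔ edge u v).connectedComponentMk w :=
    fun w => rfl
  have hiff : ∀ a b, π (G.connectedComponentMk a) = π (G.connectedComponentMk b) ↔
      G.connectedComponentMk a = G.connectedComponentMk b ∨
      (G.connectedComponentMk a = U ∧ G.connectedComponentMk b = W) ∨
      (G.connectedComponentMk a = W ∧ G.connectedComponentMk b = U) := by
    intro a b
    rw [hmk, hmk, hU, hW]
    simp only [ConnectedComponent.eq]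
    rw [reachable_sup_edge_iff, G.reachable_comm (u := v), G.reachable_comm (u := u) (v := b)]
  have hiff' : ∀ c d, π c = π d ↔ c = d ∨ (c = U ∧ d = W) ∨ (c = W ∧ d = U) := by
    intro c d
    induction c using ConnectedComponent.ind
    induction d using ConnectedComponent.ind
    exact hiff _ _
  have hsize : ∀ d, compSize d = ∑ c with π c = d, compSize c := by
    intro d
    rw [compSize_eq_card, Finset.sum_congr rfl (fun c _ => compSize_eq_card c),
      ← Finset.card_biUnion]
    · congr 1
      ext w
      simp only [Finset.mem_filter, Finset.mem_univ, true_and, Finset.mem_biUnion]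
      exact ⟨fun hw => ⟨_, (hmk w).trans hw, rfl⟩, fun ⟨c, hc, hw⟩ => by rw [← hmk, hw, hc]⟩
    · intro c _ d _ hcd
      refine Finset.disjoint_left.2 fun w hw hw' => hcd ?_
      rw [← (Finset.mem_filter.1 hw).2, ← (Finset.mem_filter.1 hw').2]
  have hinj : Set.InjOn π (Finset.univ.erase W : Finset G.ConnectedComponent) := by
    intro c hc d hd hcd
    simp only [Finset.coe_erase, Set.mem_sdiff, Set.mem_singleton_iff] at hc hd
    rcases (hiff' c d).1 hcd with h | h | h
    · exact h
    · exact absurd h.2 hd.2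
    · exact absurd h.1 hc.2
  have himg : (Finset.univ.erase W).image π = Finset.univ := by
    ext d
    simp only [Finset.mem_image, Finset.mem_erase, Finset.mem_univ, and_true, iff_true]
    obtain ⟨c, rfl⟩ := ConnectedComponent.surjective_map_ofLE
      (le_sup_left : G ≤ G ⊔ edge u v) d
    by_cases hc : c = W
    · exact ⟨U, hUW, by rw [hc]; exact (hiff' _ _).2 (Or.inr (Or.inl ⟨rfl, rfl⟩))⟩
    · exact ⟨c, hc, rfl⟩
  rw [← himg, Finset.prod_image hinj, ← Finset.mul_prod_erase _ _
    (show U ∈ Finset.univ.erase W by simp [hUW]), Finset.erase_right_comm]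
  congr 1
  · rw [hsize, ← Finset.sum_pair hUW]
    congr 2
    ext c
    simp only [Finset.mem_filter, Finset.mem_univ, true_and, Finset.mem_insert,
      Finset.mem_singleton, hiff']
    tauto
  · refine Finset.prod_congr rfl fun c hc => ?_
    simp only [Finset.mem_erase, Finset.mem_univ, and_true] at hc
    rw [hsize, ← Finset.sum_singleton compSize c]
    congr 2
    ext d
    simp only [Finset.mem_filter, Finset.mem_univ, true_and, Finset.mem_singleton, hiff']
    tauto

lemma numComponents_sup_edge (h : ¬ G.Reachable u v) :
    numComponents (G ⊔ edge u v) + 1 = numComponents G := by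
  -- the product formula with all factors equal to `2` compares powers of two
  have h1 := prod_compSize_sup_edge (fun _ => 2) h
  have h2 : G.connectedComponentMk v ∈ Finset.univ.erase (G.connectedComponentMk u) := by
    simp only [Finset.mem_erase, Finset.mem_univ, and_true]
    exact fun h' => h (ConnectedComponent.eq.1 h'.symm)
  simp only [Finset.prod_const, Finset.card_univ] at h1
  rw [← numComponents_eq_card, ← pow_succ', Finset.card_erase_of_mem h2,
    Finset.card_erase_of_mem (Finset.mem_univ _), Finset.card_univ, ← numComponents_eq_card] at h1
  have h3 := Nat.pow_right_injective (le_refl 2) h1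
  have h4 : 2 ≤ numComponents G := by
    rw [numComponents_eq_card]
    exact Fintype.one_lt_card_iff.2 ⟨_, _, fun h' => h (ConnectedComponent.eq.1 h')⟩
  omega

lemma ncard_bridges_add_numComponents (G : SimpleGraph V) :
    (bridges G).ncard + numComponents G = numComponents (removeBridges G) := by
  induction G using bridge_induction with
  | base G h => simp [removeBridges_eq_self h, h]
  | step G u v h ih =>
    rw [removeBridges_sup_edge h, bridges_sup_edge h, ← ih,
      Set.ncard_insert_of_notMem (mk_notMem_bridges h) (Set.toFinite _),
      ← numComponents_sup_edge h]
    ring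

lemma card_bridge_darts (G : SimpleGraph V) :
    (Finset.univ.filter fun p : V × V => s(p.1, p.2) ∈ bridges G).card =
      2 * (bridges G).ncard := by
  induction G using bridge_induction with
  | base G h => simp [h]
  | step G u v h ih =>
    rw [bridges_sup_edge h, Set.ncard_insert_of_notMem (mk_notMem_bridges h) (Set.toFinite _),
      mul_add, ← ih]
    have huv := ne_of_not_reachable h
    refine (congrArg Finset.card (a₂ := (Finset.univ.filter fun p : V × V =>
        s(p.1, p.2) ∈ bridges G) ∪ {(u, v), (v, u)}) ?_).trans ?_
    · ext ⟨a, b⟩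
      simp only [Set.mem_insert_iff, Sym2.eq_iff, Finset.mem_filter, Finset.mem_univ, true_and,
        Finset.mem_union, Finset.mem_insert, Finset.mem_singleton, Prod.mk.injEq]
      tauto
    rw [Finset.card_union_of_disjoint, Finset.card_pair (by simp [huv])]
    rw [Finset.disjoint_left]
    rintro ⟨a, b⟩ h1 h2
    simp only [Finset.mem_filter, Finset.mem_univ, true_and, Finset.mem_insert,
      Finset.mem_singleton, Prod.mk.injEq] at h1 h2
    refine mk_notMem_bridges h ?_
    rcases h2 with ⟨rfl, rfl⟩ | ⟨rfl, rfl⟩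
    · exact h1
    · rwa [Sym2.eq_swap]

end Components

/-! ### Exchanging cross edges and bridges -/

section Exchange

variable {V : Type*} [Fintype V]

/-- The graphs whose bridgeless part is `H`. -/
noncomputable def bridgeClass (H : SimpleGraph V) : Finset (SimpleGraph V) :=
  Finset.univ.filter fun G => removeBridges G = H

lemma mem_bridgeClass {H G : SimpleGraph V} : G ∈ bridgeClass H ↔ removeBridges G = H := by
  simp [bridgeClass]

/-- Pairs of a graph in a bridge class and an edge joining two of its components correspond to
pairs of a graph in the class and one of its bridges. Edges are counted with both orientations. -/
lemma sum_cross_eq_sum_bridges {M : Type*} [AddCommMonoid M] (H : SimpleGraph V)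
    (g : SimpleGraph V → M) :
    ∑ G ∈ bridgeClass H, ∑ p : V × V with ¬ G.Reachable p.1 p.2, g (G ⊔ edge p.1 p.2) =
      ∑ G ∈ bridgeClass H, (2 * (bridges G).ncard) • g G := by
  have : ∀ G : SimpleGraph V, (2 * (bridges G).ncard) • g G =
      ∑ p : V × V with s(p.1, p.2) ∈ bridges G, g G := by
    intro G
    rw [Finset.sum_const, card_bridge_darts]
  simp only [this]
  rw [Finset.sum_sigma', Finset.sum_sigma']
  refine Finset.sum_bij' (fun x _ => ⟨x.1 ⊔ edge x.2.1 x.2.2, x.2⟩)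
    (fun x _ => ⟨x.1.deleteEdges {s(x.2.1, x.2.2)}, x.2⟩) ?_ ?_ ?_ ?_ ?_
  · rintro ⟨G, u, v⟩ h
    simp only [Finset.mem_sigma, mem_bridgeClass, Finset.mem_filter, Finset.mem_univ,
      true_and] at h ⊢
    rw [removeBridges_sup_edge h.2, bridges_sup_edge h.2]
    exact ⟨h.1, Set.mem_insert _ _⟩
  · rintro ⟨G, u, v⟩ h
    simp only [Finset.mem_sigma, mem_bridgeClass, Finset.mem_filter, Finset.mem_univ,
      true_and] at h ⊢
    have h1 := not_reachable_deleteEdges h.2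
    refine ⟨?_, h1⟩
    rw [← removeBridges_sup_edge h1, deleteEdges_sup_edge_of_mem_bridges h.2, h.1]
  · rintro ⟨G, u, v⟩ h
    simp only [Finset.mem_sigma, Finset.mem_filter, Finset.mem_univ, true_and] at h
    simp only [deleteEdges_sup_edge h.2]
  · rintro ⟨G, u, v⟩ h
    simp only [Finset.mem_sigma, Finset.mem_filter, Finset.mem_univ, true_and] at h
    simp only [deleteEdges_sup_edge_of_mem_bridges h.2]
  · rintro ⟨G, u, v⟩ h
    rfl

/-- A sum over ordered pairs of vertices in different components, as a sum over ordered pairs of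
components. -/
lemma sum_cross_eq_sum_components {R : Type*} [CommSemiring R] (G : SimpleGraph V)
    (F : G.ConnectedComponent → G.ConnectedComponent → R) :
    ∑ p : V × V with ¬ G.Reachable p.1 p.2,
        F (G.connectedComponentMk p.1) (G.connectedComponentMk p.2) =
      ∑ c, ∑ d ∈ Finset.univ.erase c, (compSize c : R) * compSize d * F c d := by
  rw [Finset.sum_filter, Fintype.sum_prod_type]
  have h1 : ∀ u v : V, (if ¬ G.Reachable u v then
      F (G.connectedComponentMk u) (G.connectedComponentMk v) else 0) =
      (fun c d => if c ≠ d then F c d else 0) (G.connectedComponentMk u)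
        (G.connectedComponentMk v) := by
    intro u v
    simp only [ne_eq, ConnectedComponent.eq]
  simp only [h1]
  rw [sum_comp_mk (fun c => ∑ v, (fun c d => if c ≠ d then F c d else 0) c
        (G.connectedComponentMk v))]
  refine Finset.sum_congr rfl fun c _ => ?_
  rw [sum_comp_mk (fun d => (fun c d => if c ≠ d then F c d else 0) c d), nsmul_eq_mul,
    Finset.mul_sum, ← Finset.add_sum_erase _ _ (Finset.mem_univ c)]
  simp only [ne_eq, not_true_eq_false, if_false, smul_zero, mul_zero, zero_add]
  refine Finset.sum_congr rfl fun d hd => ?_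
  rw [if_pos (Finset.ne_of_mem_erase hd).symm, nsmul_eq_mul, mul_assoc]

end Exchange

/-! ### The size polynomial -/

section SizePolynomial

open Polynomial

/-- The linear functional `X ^ j ↦ j! / n ^ j` on polynomials, that is
`q ↦ ∫ t in 0..∞, q t * n * exp (-n * t)`. -/
noncomputable def laplace (n : ℝ) : ℝ[X] →ₗ[ℝ] ℝ :=
  Polynomial.lsum fun j => ((j.factorial : ℝ) / n ^ j) • LinearMap.id

lemma laplace_monomial (n : ℝ) (j : ℕ) (a : ℝ) :
    laplace n (monomial j a) = (j.factorial : ℝ) / n ^ j * a := by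
  simp [laplace, Polynomial.lsum_apply, Polynomial.sum_monomial_index]

lemma laplace_eq_sum_range (n : ℝ) (q : ℝ[X]) :
    laplace n q = ∑ j ∈ Finset.range (q.natDegree + 1), (j.factorial : ℝ) / n ^ j * q.coeff j := by
  rw [laplace, Polynomial.lsum_apply, Polynomial.sum_over_range _ (by simp)]
  simp

lemma laplace_C_mul (n a : ℝ) (q : ℝ[X]) : laplace n (C a * q) = a * laplace n q := by
  rw [C_mul', map_smul, smul_eq_mul]

/-- Integration by parts. -/
lemma mul_laplace {n : ℝ} (hn : n ≠ 0) (q : ℝ[X]) :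
    n * laplace n q = n * q.eval 0 + laplace n (derivative q) := by
  induction q using Polynomial.induction_on' with
  | add p q hp hq => simp only [map_add, eval_add, mul_add, hp, hq]; ring
  | monomial j a =>
    rw [derivative_monomial, laplace_monomial, laplace_monomial]
    cases j with
    | zero => simp
    | succ j =>
      simp only [eval_monomial, Nat.factorial_succ, Nat.add_sub_cancel]
      push_cast
      field_simp
      simp only [pow_succ]
      ring

lemma le_laplace_of_coeff_nonneg {n : ℝ} (hn : 0 < n) {q : ℝ[X]} (hq : ∀ j, 0 ≤ q.coeff j) :
    q.coeff 0 ≤ laplace n q := by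
  rw [laplace_eq_sum_range, Finset.sum_range_succ']
  simp only [Nat.factorial_zero, Nat.cast_one, pow_zero, div_one, one_mul]
  have : 0 ≤ ∑ k ∈ Finset.range q.natDegree,
      ((k + 1).factorial : ℝ) / n ^ (k + 1) * q.coeff (k + 1) :=
    Finset.sum_nonneg fun k _ => mul_nonneg (by positivity) (hq _)
  linarith

variable {ι : Type*} (S : Finset ι) (s : ι → ℝ)

/-- The polynomial `∏ (1 + s i X)`, whose coefficients are the elementary symmetric functions of
the numbers `s i`. -/
noncomputable def sizePoly : ℝ[X] := ∏ i ∈ S, (1 + C (s i) * X)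

/-- `h(s) = ∑ j ≥ 2, j! e_j(s) / n ^ j`, with `e_j` the elementary symmetric functions. If `n` is
the sum of the numbers `s i`, the first two terms of `laplace n (sizePoly S s)` are `1`, and they
are taken off here. If a set of `n` points is partitioned into parts of sizes `s i`, then
`h(s) + 1` is the expected number of independent uniform points drawn before one falls into a part
already hit. -/
noncomputable def excess (n : ℝ) : ℝ := laplace n (sizePoly S s) - 2

lemma sizePoly_eq_mul_erase {i : ι} (hi : i ∈ S) :
    sizePoly S s = (1 + C (s i) * X) * sizePoly (S.erase i) s :=
  (Finset.mul_prod_erase S _ hi).symm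

lemma eval_zero_sizePoly : (sizePoly S s).eval 0 = 1 := by
  simp [sizePoly, eval_prod]

lemma derivative_sizePoly :
    derivative (sizePoly S s) = ∑ i ∈ S, C (s i) * sizePoly (S.erase i) s := by
  rw [sizePoly, derivative_prod_finset]
  refine Finset.sum_congr rfl fun i _ => ?_
  have h : derivative (1 + C (s i) * X) = C (s i) := by simp
  rw [h, mul_comm, sizePoly]

lemma derivative_derivative_sizePoly :
    derivative (derivative (sizePoly S s)) =
      ∑ i ∈ S, ∑ l ∈ S.erase i, C (s i * s l) * sizePoly ((S.erase i).erase l) s := by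
  rw [derivative_sizePoly, derivative_sum]
  refine Finset.sum_congr rfl fun i _ => ?_
  rw [derivative_C_mul, derivative_sizePoly, Finset.mul_sum]
  refine Finset.sum_congr rfl fun l _ => ?_
  rw [C_mul, mul_assoc]

variable {S s} in
lemma coeff_sizePoly_nonneg (hs : ∀ i ∈ S, 0 ≤ s i) (j : ℕ) : 0 ≤ (sizePoly S s).coeff j := by
  induction S using Finset.induction_on generalizing j with
  | empty => simp only [sizePoly, Finset.prod_empty, coeff_one]; positivity
  | insert a S ha ih =>
    have ih := ih fun i hi => hs i (Finset.mem_insert_of_mem hi)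
    rw [sizePoly, Finset.prod_insert ha, add_mul, one_mul, mul_assoc, coeff_add, coeff_C_mul]
    refine add_nonneg (ih j) (mul_nonneg (hs a (Finset.mem_insert_self _ _)) ?_)
    cases j with
    | zero => simp
    | succ j => rw [coeff_X_mul]; exact ih j

/-- `∑ i, s i ^ 2 X P_i = n P - P'`, with `P_i` the product over all indices but `i`. -/
lemma sum_sq_mul_X_mul_erase :
    ∑ i ∈ S, C (s i) * (C (s i) * X * sizePoly (S.erase i) s) =
      C (∑ i ∈ S, s i) * sizePoly S s - derivative (sizePoly S s) := by
  rw [derivative_sizePoly, map_sum, Finset.sum_mul, ← Finset.sum_sub_distrib]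
  refine Finset.sum_congr rfl fun i hi => ?_
  rw [sizePoly_eq_mul_erase S s hi]
  ring

/-- The effect on the size polynomial `P` of merging two parts, weighted by the sum of their sizes
and added up over all ordered pairs of parts, in terms of `P` and its derivatives. -/
lemma sum_merge_sizePoly :
    ∑ i ∈ S, ∑ l ∈ S.erase i, C (s i + s l) *
        ((1 + C (s i + s l) * X) * sizePoly ((S.erase i).erase l) s) =
      2 * (C (S.card : ℝ) * (C (∑ i ∈ S, s i) * sizePoly S s)
        - C (∑ i ∈ S, s i) * (X * derivative (sizePoly S s))
        + X * derivative (derivative (sizePoly S s)) - derivative (sizePoly S s)) := by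
  set n := ∑ i ∈ S, s i with hn
  set P := sizePoly S s with hP
  have hsum : ∀ i ∈ S, ∑ l ∈ S.erase i, s l = n - s i := fun i hi => by
    rw [hn, ← Finset.add_sum_erase S s hi]; ring
  -- merging replaces `(1 + s i X) (1 + s l X)` by `1 + (s i + s l) X`
  have h1 : ∀ i ∈ S, ∀ l ∈ S.erase i, C (s i + s l) *
      ((1 + C (s i + s l) * X) * sizePoly ((S.erase i).erase l) s) =
      C (s i + s l) * P - (C (s i) * (C (s i * s l) * X ^ 2 * sizePoly ((S.erase i).erase l) s)
        + C (s l) * (C (s i * s l) * X ^ 2 * sizePoly ((S.erase i).erase l) s)) := by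
    intro i hi l hl
    rw [hP, sizePoly_eq_mul_erase S s hi, sizePoly_eq_mul_erase (S.erase i) s hl]
    simp only [C_add, C_mul]
    ring
  have h2 : ∑ i ∈ S, ∑ l ∈ S.erase i, C (s i + s l) * P =
      2 * (C (S.card : ℝ) * (C n * P) - C n * P) := by
    have : ∀ i ∈ S, ∑ l ∈ S.erase i, C (s i + s l) * P =
        C ((S.card - 2) * s i + n) * P := by
      intro i hi
      rw [← Finset.sum_mul, ← map_sum, Finset.sum_add_distrib, hsum i hi, Finset.sum_const,
        Finset.card_erase_of_mem hi, nsmul_eq_mul,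
        Nat.cast_sub (Finset.card_pos.2 ⟨i, hi⟩)]
      congr 2
      push_cast
      ring
    rw [Finset.sum_congr rfl this, ← Finset.sum_mul, ← map_sum, Finset.sum_add_distrib,
      ← Finset.mul_sum, ← hn, Finset.sum_const, nsmul_eq_mul]
    simp only [C_add, C_mul, C_sub, map_ofNat]
    ring
  have h3 : ∑ i ∈ S, ∑ l ∈ S.erase i,
      C (s l) * (C (s i * s l) * X ^ 2 * sizePoly ((S.erase i).erase l) s) =
      C n * (X * derivative P) - (C n * P - derivative P)
        - X * derivative (derivative P) := by
    have : ∀ i ∈ S, ∑ l ∈ S.erase i,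
        C (s l) * (C (s i * s l) * X ^ 2 * sizePoly ((S.erase i).erase l) s) =
        C n * (X * (C (s i) * sizePoly (S.erase i) s))
          - C (s i) * (C (s i) * X * sizePoly (S.erase i) s)
          - X * ∑ l ∈ S.erase i, C (s i * s l) * sizePoly ((S.erase i).erase l) s := by
      intro i hi
      have e := sum_sq_mul_X_mul_erase (S.erase i) s
      rw [hsum i hi, derivative_sizePoly] at e
      have e' : ∑ l ∈ S.erase i,
          C (s l) * (C (s i * s l) * X ^ 2 * sizePoly ((S.erase i).erase l) s) =
          C (s i) * X * ∑ l ∈ S.erase i,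
            C (s l) * (C (s l) * X * sizePoly ((S.erase i).erase l) s) := by
        rw [Finset.mul_sum]
        refine Finset.sum_congr rfl fun l _ => ?_
        rw [C_mul]; ring
      have e'' : ∑ l ∈ S.erase i, C (s i * s l) * sizePoly ((S.erase i).erase l) s =
          C (s i) * ∑ l ∈ S.erase i, C (s l) * sizePoly ((S.erase i).erase l) s := by
        rw [Finset.mul_sum]
        refine Finset.sum_congr rfl fun l _ => ?_
        rw [C_mul]; ring
      rw [e', e'', e, C_sub]
      ring
    rw [Finset.sum_congr rfl this, Finset.sum_sub_distrib, Finset.sum_sub_distrib,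
      ← Finset.mul_sum, ← Finset.mul_sum, ← Finset.mul_sum, ← derivative_derivative_sizePoly,
      ← derivative_sizePoly, sum_sq_mul_X_mul_erase]
  have h4 : ∑ i ∈ S, ∑ l ∈ S.erase i,
      C (s i) * (C (s i * s l) * X ^ 2 * sizePoly ((S.erase i).erase l) s) =
      ∑ i ∈ S, ∑ l ∈ S.erase i,
        C (s l) * (C (s i * s l) * X ^ 2 * sizePoly ((S.erase i).erase l) s) := by
    rw [Finset.sum_comm' (t' := S) (s' := fun l => S.erase l)]
    · refine Finset.sum_congr rfl fun i _ => Finset.sum_congr rfl fun l _ => ?_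
      rw [Finset.erase_right_comm, mul_comm (s i)]
    · intro i l
      simp only [Finset.mem_erase]
      tauto
  rw [Finset.sum_congr rfl fun i hi => Finset.sum_congr rfl (h1 i hi)]
  simp only [Finset.sum_sub_distrib, Finset.sum_add_distrib]
  rw [h2, h4, h3]
  ring

variable {S s}

/-- Merging a random pair of parts, chosen with weight proportional to the sum of their sizes,
multiplies the mean of `excess` by `(k - 2) / (k - 1)`, where `k` is the number of parts. -/
lemma sum_merge_excess {n : ℝ} (hn : n ≠ 0) (hs : ∑ i ∈ S, s i = n) :
    ∑ i ∈ S, ∑ l ∈ S.erase i, (s i + s l) *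
        (laplace n ((1 + C (s i + s l) * X) * sizePoly ((S.erase i).erase l) s) - 2) =
      2 * (n * ((S.card - 2) * excess S s n)) := by
  have e := congrArg (laplace n) (sum_merge_sizePoly S s)
  have e0 := congrArg (Polynomial.eval 0) (sum_merge_sizePoly S s)
  have hd := mul_laplace hn (sizePoly S s)
  have hXd := mul_laplace hn (X * derivative (sizePoly S s))
  have hd0 : (derivative (sizePoly S s)).eval 0 = n := by
    rw [derivative_sizePoly, ← hs, eval_finsetSum]
    simp [eval_zero_sizePoly]
  rw [hs] at e e0
  have e2 : (2 : ℝ[X]) = C 2 := (map_ofNat C 2).symm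
  simp only [map_sum, laplace_C_mul] at e
  rw [e2, laplace_C_mul] at e
  simp only [LinearMap.map_sub, LinearMap.map_add, laplace_C_mul] at e
  simp only [derivative_mul, derivative_X, one_mul, map_add, eval_mul, eval_X, zero_mul,
    mul_zero, zero_add] at hXd
  simp only [eval_finsetSum, eval_mul, eval_add, eval_sub, eval_C, eval_X, eval_one, mul_zero,
    zero_mul, add_zero, eval_zero_sizePoly, mul_one, hd0, sub_zero, eval_ofNat] at e0
  rw [eval_zero_sizePoly] at hd
  simp only [mul_sub, Finset.sum_sub_distrib, ← Finset.sum_mul]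
  rw [e, e0, excess]
  linear_combination (-2) * hXd + 4 * hd

lemma le_excess {n : ℝ} (hn : 0 < n) (hs : ∑ i ∈ S, s i = n) (hs0 : ∀ i ∈ S, 0 ≤ s i) :
    ∑ i ∈ S, ∑ l ∈ S.erase i, s i * s l ≤ n ^ 2 * excess S s n := by
  have h1 := mul_laplace hn.ne' (sizePoly S s)
  have h2 := mul_laplace hn.ne' (derivative (sizePoly S s))
  have hd0 : (derivative (sizePoly S s)).eval 0 = n := by
    rw [derivative_sizePoly, ← hs, eval_finsetSum]
    simp [eval_zero_sizePoly]
  rw [eval_zero_sizePoly] at h1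
  rw [hd0] at h2
  have h3 : n ^ 2 * excess S s n = laplace n (derivative (derivative (sizePoly S s))) := by
    rw [excess]; linear_combination n * h1 + h2
  rw [h3, derivative_derivative_sizePoly]
  simp only [map_sum, laplace_C_mul]
  refine Finset.sum_le_sum fun i hi => Finset.sum_le_sum fun l hl => ?_
  refine le_mul_of_one_le_right
    (mul_nonneg (hs0 i hi) (hs0 l (Finset.mem_of_mem_erase hl))) ?_
  have := le_laplace_of_coeff_nonneg hn (coeff_sizePoly_nonneg (S := (S.erase i).erase l)
    (s := s) fun j hj => hs0 j (Finset.mem_of_mem_erase (Finset.mem_of_mem_erase hj)))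
  rwa [coeff_zero_eq_eval_zero, eval_zero_sizePoly] at this

/-- If all parts have size at least `1`, the terms `ρ j = j! e_j / n ^ j` of `laplace n P` satisfy
`ρ (j + 1) ≤ (1 - j / n) ρ j`. Hence they are at most `1`, and `∑ j ρ j ≤ n` by telescoping; a cut
at `j ≈ √n` bounds their sum. -/
lemma excess_le {n : ℝ} (hn : 0 < n) (hs : ∑ i ∈ S, s i = n) (hs1 : ∀ i ∈ S, 1 ≤ s i) :
    excess S s n ≤ 2 * √n := by
  set P := sizePoly S s with hP
  set ρ : ℕ → ℝ := fun j => (j.factorial : ℝ) / n ^ j * P.coeff j with hρ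
  have hρ0 : ∀ j, 0 ≤ ρ j := fun j => mul_nonneg (by positivity)
    (coeff_sizePoly_nonneg (fun i hi => zero_le_one.trans (hs1 i hi)) j)
  have hcoeff : ∀ j : ℕ, (j + 1) * P.coeff (j + 1) ≤ (n - j) * P.coeff j := by
    intro j
    have e := congrArg (fun q => q.coeff j) (sum_sq_mul_X_mul_erase S s)
    have e' := congrArg (fun q => (X * q).coeff j) (derivative_sizePoly S s)
    simp only [Finset.mul_sum, finsetSum_coeff, coeff_sub, coeff_derivative, hs, coeff_C_mul,
      mul_assoc, ← hP, mul_left_comm X (C _)] at e e'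
    have h : j * P.coeff j = (X * derivative P).coeff j := by
      cases j with
      | zero => simp
      | succ j => rw [coeff_X_mul, coeff_derivative]; push_cast; ring
    have h' : ∑ i ∈ S, s i * (X * sizePoly (S.erase i) s).coeff j ≤
        ∑ i ∈ S, s i * (s i * (X * sizePoly (S.erase i) s).coeff j) := by
      refine Finset.sum_le_sum fun i hi => mul_le_mul_of_nonneg_left ?_
        (zero_le_one.trans (hs1 i hi))
      refine le_mul_of_one_le_left ?_ (hs1 i hi)
      cases j with
      | zero => simp
      | succ j =>
        rw [coeff_X_mul]
        exact coeff_sizePoly_nonneg (fun i hi =>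
          zero_le_one.trans (hs1 i (Finset.mem_of_mem_erase hi))) j
    rw [← e', e, ← h] at h'
    linarith
  have hstep : ∀ j : ℕ, j * ρ j ≤ n * (ρ j - ρ (j + 1)) := by
    intro j
    have h := mul_le_mul_of_nonneg_left (hcoeff j)
      (show 0 ≤ (j.factorial : ℝ) / n ^ j by positivity)
    have h1 : n * ρ (j + 1) = (j.factorial : ℝ) / n ^ j * ((j + 1) * P.coeff (j + 1)) := by
      simp only [hρ, Nat.factorial_succ, pow_succ]
      push_cast
      field_simp
    rw [mul_sub, h1]
    simp only [hρ]
    linarith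
  have hone : ρ 0 = 1 := by
    simp [hρ, coeff_zero_eq_eval_zero, hP, eval_zero_sizePoly]
  have hle1 : ∀ j, ρ j ≤ 1 := by
    intro j
    induction j with
    | zero => exact hone.le
    | succ j ih =>
      have h1 : 0 ≤ n * (ρ j - ρ (j + 1)) :=
        (mul_nonneg (Nat.cast_nonneg j) (hρ0 j)).trans (hstep j)
      have := nonneg_of_mul_nonneg_right h1 hn
      linarith
  have htel : ∀ N : ℕ, ∑ j ∈ Finset.range N, j * ρ j ≤ n := by
    intro N
    calc ∑ j ∈ Finset.range N, j * ρ j ≤ ∑ j ∈ Finset.range N, n * (ρ j - ρ (j + 1)) :=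
          Finset.sum_le_sum fun j _ => hstep j
      _ = n * (ρ 0 - ρ N) := by rw [← Finset.mul_sum, Finset.sum_range_sub']
      _ ≤ n := by nlinarith [hρ0 N]
  have hr : 0 < √n := Real.sqrt_pos.2 hn
  have hterm : ∀ j : ℕ, ρ j ≤ (if j < ⌈√n⌉₊ then 1 else 0) + j * ρ j / √n := by
    intro j
    have h0 : 0 ≤ j * ρ j / √n := div_nonneg (mul_nonneg (Nat.cast_nonneg j) (hρ0 j)) hr.le
    split_ifs with h
    · linarith [hle1 j]
    · rw [zero_add, le_div_iff₀ hr, mul_comm]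
      exact mul_le_mul_of_nonneg_right (Nat.ceil_le.1 (not_lt.1 h)) (hρ0 j)
  have hcard : ∀ N K : ℕ, ∑ j ∈ Finset.range N, (if j < K then (1 : ℝ) else 0) ≤ K := by
    intro N K
    rw [← Finset.sum_filter, Finset.sum_const, nsmul_one]
    have : (Finset.range N).filter (· < K) ⊆ Finset.range K := fun j hj =>
      Finset.mem_range.2 (Finset.mem_filter.1 hj).2
    simpa using Finset.card_le_card this
  have hceil := (Nat.ceil_lt_add_one hr.le).le
  have hfin : laplace n P ≤ ⌈√n⌉₊ + n / √n := by
    rw [laplace_eq_sum_range]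
    refine (Finset.sum_le_sum fun j _ => hterm j).trans ?_
    rw [Finset.sum_add_distrib, ← Finset.sum_div]
    exact add_le_add (hcard _ _) (div_le_div_of_nonneg_right (htel _) hr.le)
  rw [Real.div_sqrt] at hfin
  rw [excess]
  linarith

end SizePolynomial

/-! ### Recursions for a bridge class, by number of components -/

section Levels

open Polynomial

variable {V : Type*} [Fintype V]

/-- The product of the component sizes. -/
noncomputable def sizeProd (G : SimpleGraph V) : ℝ :=
  ∏ c : G.ConnectedComponent, (compSize c : ℝ)

/-- The functional `excess` of the component sizes. -/
noncomputable def graphExcess (G : SimpleGraph V) : ℝ :=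
  excess Finset.univ (fun c : G.ConnectedComponent => (compSize c : ℝ)) (Fintype.card V)

lemma compSize_pos {G : SimpleGraph V} (c : G.ConnectedComponent) : (0 : ℝ) < compSize c :=
  Nat.cast_pos.2 (one_le_compSize c)

lemma sizeProd_pos (G : SimpleGraph V) : 0 < sizeProd G :=
  Finset.prod_pos fun c _ => compSize_pos c

lemma sum_compSize_cast (G : SimpleGraph V) :
    ∑ c : G.ConnectedComponent, (compSize c : ℝ) = Fintype.card V := by
  exact_mod_cast sum_compSize G

lemma sizeProd_sup_edge {G : SimpleGraph V} {u v : V} (h : ¬ G.Reachable u v) :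
    (compSize (G.connectedComponentMk u) : ℝ) * compSize (G.connectedComponentMk v) *
      sizeProd (G ⊔ edge u v) = sizeProd G *
        (compSize (G.connectedComponentMk u) + compSize (G.connectedComponentMk v)) := by
  have hne : G.connectedComponentMk v ∈ Finset.univ.erase (G.connectedComponentMk u) := by
    simp only [Finset.mem_erase, Finset.mem_univ, and_true]
    exact fun h' => h (ConnectedComponent.eq.1 h'.symm)
  rw [sizeProd, sizeProd, prod_compSize_sup_edge (fun k => (k : ℝ)) h,
    ← Finset.mul_prod_erase _ _ (Finset.mem_univ (G.connectedComponentMk u)),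
    ← Finset.mul_prod_erase _ _ hne]
  push_cast
  ring

/-- Adding an edge between components of sizes `a` and `b` replaces the factor `a b` of `sizeProd` by
`a + b`, and there are `a b` such edges. So a sum over cross edges weighted by `sizeProd` is a sum
over pairs of components weighted by `a + b`. -/
lemma sum_cross_sizeProd_mul (G : SimpleGraph V) (q : SimpleGraph V → ℝ)
    (F : G.ConnectedComponent → G.ConnectedComponent → ℝ)
    (hF : ∀ u v, ¬ G.Reachable u v →
      q (G ⊔ edge u v) = F (G.connectedComponentMk u) (G.connectedComponentMk v)) :
    ∑ p : V × V with ¬ G.Reachable p.1 p.2,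
        sizeProd (G ⊔ edge p.1 p.2) * q (G ⊔ edge p.1 p.2) =
      sizeProd G * ∑ c, ∑ d ∈ Finset.univ.erase c, (compSize c + compSize d : ℝ) * F c d := by
  have h1 : ∀ p ∈ Finset.univ.filter fun p : V × V => ¬ G.Reachable p.1 p.2,
      sizeProd (G ⊔ edge p.1 p.2) * q (G ⊔ edge p.1 p.2) =
      (fun c d => sizeProd G * (compSize c + compSize d : ℝ) / (compSize c * compSize d) * F c d)
        (G.connectedComponentMk p.1) (G.connectedComponentMk p.2) := by
    rintro ⟨u, v⟩ hp
    have hp := (Finset.mem_filter.1 hp).2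
    simp only at hp ⊢
    rw [hF u v hp, ← sizeProd_sup_edge hp, mul_div_cancel_left₀]
    exact (mul_pos (compSize_pos _) (compSize_pos _)).ne'
  rw [Finset.sum_congr rfl h1]
  refine (sum_cross_eq_sum_components G (fun c d =>
    sizeProd G * (compSize c + compSize d : ℝ) / (compSize c * compSize d) * F c d)).trans ?_
  rw [Finset.mul_sum]
  refine Finset.sum_congr rfl fun c _ => ?_
  rw [Finset.mul_sum]
  refine Finset.sum_congr rfl fun d _ => ?_
  have := (compSize_pos c).ne'
  have := (compSize_pos d).ne'
  field_simp

lemma sum_cross_sizeProd (G : SimpleGraph V) :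
    ∑ p : V × V with ¬ G.Reachable p.1 p.2, sizeProd (G ⊔ edge p.1 p.2) =
      2 * (Fintype.card V * ((numComponents G - 1) * sizeProd G)) := by
  have h := sum_cross_sizeProd_mul G (fun _ => 1) (fun _ _ => 1) (fun _ _ _ => rfl)
  simp only [mul_one] at h
  rw [h]
  have h1 : ∀ c : G.ConnectedComponent,
      ∑ d ∈ Finset.univ.erase c, (compSize c + compSize d : ℝ) =
      (numComponents G - 2) * compSize c + Fintype.card V := by
    intro c
    have h2 : ∑ d ∈ Finset.univ.erase c, (compSize d : ℝ) = Fintype.card V - compSize c := by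
      rw [← sum_compSize_cast G, ← Finset.add_sum_erase _ _ (Finset.mem_univ c)]; ring
    rw [Finset.sum_add_distrib, h2, Finset.sum_const, Finset.card_erase_of_mem (Finset.mem_univ c),
      nsmul_eq_mul, Nat.cast_sub (Finset.card_pos.2 ⟨c, Finset.mem_univ c⟩), Finset.card_univ,
      numComponents_eq_card]
    push_cast
    ring
  simp only [h1]
  rw [Finset.sum_add_distrib, ← Finset.mul_sum, sum_compSize_cast, Finset.sum_const,
    Finset.card_univ, nsmul_eq_mul, ← numComponents_eq_card]
  ring

lemma sum_cross_sizeProd_mul_graphExcess [Nonempty V] (G : SimpleGraph V) :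
    ∑ p : V × V with ¬ G.Reachable p.1 p.2,
        sizeProd (G ⊔ edge p.1 p.2) * graphExcess (G ⊔ edge p.1 p.2) =
      2 * (Fintype.card V * ((numComponents G - 2) * (sizeProd G * graphExcess G))) := by
  rw [sum_cross_sizeProd_mul G graphExcess (fun c d => laplace (Fintype.card V)
    ((1 + C (compSize c + compSize d : ℝ) * X) * sizePoly ((Finset.univ.erase c).erase d)
      (fun c : G.ConnectedComponent => (compSize c : ℝ))) - 2), sum_merge_excess
    (Nat.cast_ne_zero.2 Fintype.card_ne_zero) (sum_compSize_cast G), Finset.card_univ,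
    ← numComponents_eq_card, graphExcess]
  · ring
  · intro u v h
    rw [graphExcess, excess, sizePoly, prod_compSize_sup_edge
      (fun k => (1 + C (k : ℝ) * X)) h, sizePoly]
    push_cast
    rfl

/-- The sum of `q` over the graphs with `j` components in the bridge class of `H`. -/
noncomputable def levelSum (H : SimpleGraph V) (j : ℕ) (q : SimpleGraph V → ℝ) : ℝ :=
  ∑ G ∈ bridgeClass H with numComponents G = j, q G

/-- Exchanging cross edges and bridges, by number of components. -/
lemma levelSum_exchange (H : SimpleGraph V) (j : ℕ) (q : SimpleGraph V → ℝ) :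
    2 * ((numComponents H - j) * levelSum H j q) =
      levelSum H (j + 1)
        (fun G => ∑ p : V × V with ¬ G.Reachable p.1 p.2, q (G ⊔ edge p.1 p.2)) := by
  have h := sum_cross_eq_sum_bridges H (fun G => if numComponents G = j then q G else 0)
  rw [levelSum, levelSum, Finset.mul_sum, Finset.mul_sum, Finset.sum_filter, Finset.sum_filter]
  refine Eq.trans (Finset.sum_congr rfl fun G hG => ?_)
    (h.symm.trans (Finset.sum_congr rfl fun G hG => ?_))
  · have := ncard_bridges_add_numComponents G
    rw [mem_bridgeClass.1 hG] at this
    split_ifs with hj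
    · rw [nsmul_eq_mul, ← this, hj]
      push_cast
      ring
    · simp
  · split_ifs with hj
    · refine Finset.sum_congr rfl fun p hp => if_pos ?_
      have := numComponents_sup_edge (Finset.mem_filter.1 hp).2
      omega
    · refine Finset.sum_eq_zero fun p hp => if_neg ?_
      have := numComponents_sup_edge (Finset.mem_filter.1 hp).2
      omega

lemma levelSum_const_mul (H : SimpleGraph V) (j : ℕ) (q : SimpleGraph V → ℝ) (a : ℝ) :
    levelSum H j (fun G => a * q G) = a * levelSum H j q := by
  rw [levelSum, levelSum, Finset.mul_sum]

lemma levelSum_congr {H : SimpleGraph V} {j : ℕ} {q r : SimpleGraph V → ℝ}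
    (h : ∀ G ∈ bridgeClass H, numComponents G = j → q G = r G) :
    levelSum H j q = levelSum H j r :=
  Finset.sum_congr rfl fun G hG => h G (Finset.mem_filter.1 hG).1 (Finset.mem_filter.1 hG).2

lemma levelSum_nonneg {H : SimpleGraph V} {j : ℕ} {q : SimpleGraph V → ℝ} (h : ∀ G, 0 ≤ q G) :
    0 ≤ levelSum H j q := Finset.sum_nonneg fun G _ => h G

lemma levelSum_sizeProd (H : SimpleGraph V) (j : ℕ) :
    (numComponents H - j) * levelSum H j sizeProd =
      Fintype.card V * (j * levelSum H (j + 1) sizeProd) := by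
  have h := levelSum_exchange H j sizeProd
  rw [levelSum_congr (j := j + 1) (r := fun G => 2 * (Fintype.card V * (j * sizeProd G)))] at h
  · simp only [levelSum_const_mul] at h
    linarith
  · intro G _ hG
    rw [sum_cross_sizeProd, hG]
    push_cast
    ring

lemma levelSum_sizeProd_mul_graphExcess [Nonempty V] (H : SimpleGraph V) (j : ℕ) :
    (numComponents H - j) * levelSum H j (fun G => sizeProd G * graphExcess G) =
      Fintype.card V * ((j - 1) * levelSum H (j + 1) (fun G => sizeProd G * graphExcess G)) := by
  have h := levelSum_exchange H j (fun G => sizeProd G * graphExcess G)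
  rw [levelSum_congr (j := j + 1) (r := fun G =>
    2 * (Fintype.card V * ((j - 1) * (sizeProd G * graphExcess G))))] at h
  · simp only [levelSum_const_mul] at h
    linarith
  · intro G _ hG
    rw [sum_cross_sizeProd_mul_graphExcess, hG]
    push_cast
    ring

/-- Both recursions started at `H`, the only graph of its class with the maximal number of
components: the mean of `excess` over the graphs with `k` components, weighted by the product of
the component sizes, is `(k - 1) / (m - 1)` times its value at `H`. -/
lemma levelSum_graphExcess_eq [Nonempty V] {H : SimpleGraph V} {k : ℕ} (hk : 1 ≤ k)
    (hkm : k ≤ numComponents H) :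
    (numComponents H - 1) * levelSum H k (fun G => sizeProd G * graphExcess G) =
      (k - 1) * (graphExcess H * levelSum H k sizeProd) := by
  induction hkm using Nat.decreasingInduction with
  | self =>
    rw [← levelSum_const_mul H _ sizeProd (graphExcess H)]
    refine congrArg _ (levelSum_congr fun G hG hGm => ?_)
    have h := ncard_bridges_add_numComponents G
    rw [mem_bridgeClass.1 hG, hGm, add_eq_right, Set.ncard_eq_zero (Set.toFinite _)] at h
    rw [← mem_bridgeClass.1 hG, removeBridges_eq_self h, mul_comm]
  | of_succ j hj ih =>
    have hpos : (0 : ℝ) < numComponents H - j := by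
      have : (j : ℝ) < numComponents H := by exact_mod_cast hj
      linarith
    have h1 := levelSum_sizeProd H j
    have h2 := levelSum_sizeProd_mul_graphExcess H j
    have h3 := ih (by omega)
    push_cast at h3
    refine mul_left_cancel₀ hpos.ne' ?_
    linear_combination (numComponents H - 1 : ℝ) * h2 + (Fintype.card V * (j - 1) : ℝ) * h3 -
      ((j - 1) * graphExcess H) * h1

lemma numComponents_le_card (H : SimpleGraph V) : numComponents H ≤ Fintype.card V := by
  rw [← sum_compSize H, numComponents_eq_card, ← Finset.card_univ, Finset.card_eq_sum_ones]
  exact Finset.sum_le_sum fun c _ => one_le_compSize c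

lemma graphExcess_nonneg [Nonempty V] (G : SimpleGraph V) : 0 ≤ graphExcess G := by
  have hn : (0 : ℝ) < Fintype.card V := Nat.cast_pos.2 Fintype.card_pos
  have h := le_excess hn (sum_compSize_cast G) fun c _ => (compSize_pos c).le
  refine nonneg_of_mul_nonneg_right (le_trans ?_ h) (pow_pos hn 2)
  exact Finset.sum_nonneg fun c _ => Finset.sum_nonneg fun d _ =>
    mul_nonneg (compSize_pos c).le (compSize_pos d).le

lemma graphExcess_le [Nonempty V] (G : SimpleGraph V) :
    graphExcess G ≤ 2 * √(Fintype.card V) :=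
  excess_le (Nat.cast_pos.2 Fintype.card_pos) (sum_compSize_cast G)
    fun c _ => by exact_mod_cast one_le_compSize c

/-- A connected graph has a single component, of size `n`. -/
lemma levelSum_one_sizeProd (H : SimpleGraph V) :
    levelSum H 1 sizeProd = Fintype.card V * levelSum H 1 (fun _ => 1) := by
  rw [← levelSum_const_mul]
  refine levelSum_congr fun G _ hG => ?_
  rw [numComponents_eq_card] at hG
  obtain ⟨c, hc⟩ := Fintype.card_eq_one_iff.1 hG
  have huniv : (Finset.univ : Finset G.ConnectedComponent) = {c} :=
    Finset.eq_singleton_iff_unique_mem.2 ⟨Finset.mem_univ c, fun d _ => hc d⟩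
  rw [sizeProd, ← sum_compSize_cast G, huniv]
  simp

/-- The recursion `levelSum_sizeProd`, started at the connected graphs; each step costs a factor at
most `1 / j`, because `m ≤ n`. -/
lemma levelSum_sizeProd_le [Nonempty V] (H : SimpleGraph V) (i : ℕ) :
    levelSum H (i + 2) sizeProd ≤
      (numComponents H - 1) * levelSum H 1 (fun _ => 1) / (i + 1).factorial := by
  have hn : (0 : ℝ) < Fintype.card V := Nat.cast_pos.2 Fintype.card_pos
  induction i with
  | zero =>
    have h := levelSum_sizeProd H 1
    rw [levelSum_one_sizeProd] at h
    refine le_of_eq (mul_left_cancel₀ hn.ne' ?_)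
    simp only [zero_add, Nat.factorial_one, Nat.cast_one, one_mul, div_one] at h ⊢
    linarith
  | succ i ih =>
    have h := levelSum_sizeProd H (i + 2)
    have h0 : 0 ≤ levelSum H (i + 2) sizeProd := levelSum_nonneg fun G => (sizeProd_pos G).le
    have h1 : (numComponents H - (i + 2 : ℕ) : ℝ) ≤ Fintype.card V := by
      have : (numComponents H : ℝ) ≤ Fintype.card V := by
        exact_mod_cast numComponents_le_card H
      have : (0 : ℝ) ≤ (i + 2 : ℕ) := Nat.cast_nonneg _
      linarith
    have h2 := mul_le_mul_of_nonneg_right h1 h0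
    rw [h] at h2
    have h3 := (le_of_mul_le_mul_left h2 hn).trans ih
    rw [show i + 1 + 2 = i + 2 + 1 by ring, show i + 1 + 1 = (i + 1) + 1 by ring,
      Nat.factorial_succ (i + 1)]
    rw [le_div_iff₀ (by positivity)] at h3 ⊢
    push_cast at h3 ⊢
    linarith

lemma levelSum_sizeProd_mul_graphExcess_le [Nonempty V] (H : SimpleGraph V) {i : ℕ}
    (hi : i + 2 ≤ numComponents H) :
    levelSum H (i + 2) (fun G => sizeProd G * graphExcess G) ≤
      graphExcess H * levelSum H 1 (fun _ => 1) / i.factorial := by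
  have h := levelSum_graphExcess_eq (H := H) (k := i + 2) (by omega) hi
  have h' := mul_le_mul_of_nonneg_left (levelSum_sizeProd_le H i)
    (mul_nonneg (show (0 : ℝ) ≤ i + 1 by positivity) (graphExcess_nonneg H))
  have hpos : (0 : ℝ) < numComponents H - 1 := by
    have : ((i + 2 : ℕ) : ℝ) ≤ numComponents H := by exact_mod_cast hi
    push_cast at this
    have : (0 : ℝ) ≤ i := Nat.cast_nonneg i
    linarith
  refine le_of_mul_le_mul_left ?_ hpos
  rw [h]
  refine le_trans (le_of_eq ?_) (h'.trans (le_of_eq ?_))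
  · push_cast; ring
  · rw [Nat.factorial_succ]
    push_cast
    field_simp

end Levels

/-! ### The fragment and the component sizes -/

section Frag

variable {V : Type*} [Fintype V]

/-- Twice the number of edges joining different components, as a function of component sizes. -/
noncomputable def pairSum (G : SimpleGraph V) : ℝ :=
  ∑ c : G.ConnectedComponent, ∑ d ∈ Finset.univ.erase c, (compSize c : ℝ) * compSize d

lemma pairSum_eq (G : SimpleGraph V) :
    pairSum G = (Fintype.card V : ℝ) ^ 2 - ∑ c : G.ConnectedComponent, (compSize c : ℝ) ^ 2 := by
  rw [pairSum, ← sum_compSize_cast G, sq, Finset.sum_mul, ← Finset.sum_sub_distrib]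
  refine Finset.sum_congr rfl fun c _ => ?_
  rw [← Finset.mul_sum, ← Finset.add_sum_erase _ _ (Finset.mem_univ c)]
  ring

lemma card_cross (G : SimpleGraph V) :
    ((Finset.univ.filter fun p : V × V => ¬ G.Reachable p.1 p.2).card : ℝ) = pairSum G := by
  have h := sum_cross_eq_sum_components G (R := ℝ) (fun _ _ => 1)
  simp only [mul_one] at h
  rw [pairSum, ← h, Finset.sum_const, nsmul_one]

lemma exists_largest_component [Nonempty V] (G : SimpleGraph V) :
    ∃ c₀ : G.ConnectedComponent, (frag G : ℝ) + compSize c₀ = Fintype.card V ∧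
      ∑ c ∈ Finset.univ.erase c₀, (compSize c : ℝ) = frag G ∧
      ∀ c : G.ConnectedComponent, compSize c ≤ compSize c₀ := by
  obtain ⟨c₀, hc₀⟩ := exists_eq_ciSup_of_finite (f := fun c : G.ConnectedComponent => c.supp.ncard)
  have hsum := sum_compSize G
  rw [← Finset.add_sum_erase _ _ (Finset.mem_univ c₀)] at hsum
  have hfrag : frag G = ∑ c ∈ Finset.univ.erase c₀, compSize c := by
    rw [frag, ← hc₀, Nat.card_eq_fintype_card, ← hsum]
    simp [compSize]
  refine ⟨c₀, ?_, ?_, fun c => ?_⟩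
  · rw [← hsum, hfrag]; push_cast; ring
  · rw [hfrag]; push_cast; rfl
  · have := le_ciSup (f := fun c : G.ConnectedComponent => c.supp.ncard)
      (Set.finite_range _).bddAbove c
    rw [← hc₀] at this
    exact this

lemma frag_eq_zero_of_numComponents_le_one [Nonempty V] {G : SimpleGraph V}
    (h : numComponents G ≤ 1) : frag G = 0 := by
  obtain ⟨c₀, -, h2, -⟩ := exists_largest_component G
  have : (Finset.univ.erase c₀ : Finset G.ConnectedComponent) = ∅ := by
    rw [← Finset.card_eq_zero, Finset.card_erase_of_mem (Finset.mem_univ _), Finset.card_univ,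
      ← numComponents_eq_card]
    omega
  rw [this, Finset.sum_empty] at h2
  exact_mod_cast h2.symm

lemma numComponents_pos [Nonempty V] (G : SimpleGraph V) : 0 < numComponents G := by
  rw [numComponents_eq_card]; exact Fintype.card_pos

lemma numComponents_le_frag_add_one [Nonempty V] (G : SimpleGraph V) :
    (numComponents G : ℝ) ≤ frag G + 1 := by
  obtain ⟨c₀, -, h2, -⟩ := exists_largest_component G
  have h : ((Finset.univ.erase c₀ : Finset G.ConnectedComponent).card : ℝ) ≤
      ∑ c ∈ Finset.univ.erase c₀, (compSize c : ℝ) := by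
    rw [Finset.card_eq_sum_ones]
    push_cast
    exact Finset.sum_le_sum fun c _ => by exact_mod_cast one_le_compSize c
  rw [h2, Finset.card_erase_of_mem (Finset.mem_univ _), Finset.card_univ,
    ← numComponents_eq_card, Nat.cast_sub (numComponents_pos G)] at h
  push_cast at h
  linarith

/-- Every vertex outside a largest component can be joined to every vertex inside. -/
lemma card_mul_frag_le [Nonempty V] (G : SimpleGraph V) :
    (Fintype.card V : ℝ) * frag G ≤ pairSum G / 2 + (frag G : ℝ) ^ 2 := by
  obtain ⟨c₀, h1, h2, -⟩ := exists_largest_component G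
  have h : ∑ c ∈ Finset.univ.erase c₀, (compSize c : ℝ) ^ 2 ≤ (frag G : ℝ) ^ 2 := by
    rw [← h2]
    exact Finset.sum_sq_le_sq_sum_of_nonneg fun c _ => (compSize_pos c).le
  rw [pairSum_eq, ← Finset.add_sum_erase _ _ (Finset.mem_univ c₀), ← h1]
  nlinarith

lemma pairSum_le [Nonempty V] (G : SimpleGraph V) :
    pairSum G ≤ 2 * (Fintype.card V * frag G) := by
  obtain ⟨c₀, h1, -, -⟩ := exists_largest_component G
  have h : (0 : ℝ) ≤ ∑ c ∈ Finset.univ.erase c₀, (compSize c : ℝ) ^ 2 :=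
    Finset.sum_nonneg fun c _ => by positivity
  rw [pairSum_eq, ← Finset.add_sum_erase _ _ (Finset.mem_univ c₀), ← h1]
  nlinarith [sq_nonneg (frag G : ℝ)]

/-- With `M` the size of a largest component and `k` the number of components, `k M ≥ n`, the
product of the sizes is at least `M * frag / k`, and there are at least `M * frag` cross edges. -/
lemma frag_sq_le [Nonempty V] (G : SimpleGraph V) :
    (frag G : ℝ) ^ 2 ≤ (numComponents G : ℝ) ^ 3 * (sizeProd G * graphExcess G) := by
  obtain ⟨c₀, h1, h2, h3⟩ := exists_largest_component G
  set k : ℝ := (numComponents G : ℝ) with hk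
  set M : ℝ := (compSize c₀ : ℝ) with hM
  set f : ℝ := (frag G : ℝ) with hf
  set n : ℝ := (Fintype.card V : ℝ) with hn
  have hn0 : 0 < n := Nat.cast_pos.2 Fintype.card_pos
  have hf0 : 0 ≤ f := Nat.cast_nonneg _
  have hM0 : 0 < M := compSize_pos c₀
  have hk0 : 0 < k := Nat.cast_pos.2 (numComponents_pos G)
  have hkM : n ≤ k * M := by
    rw [hn, ← sum_compSize_cast G, hk, numComponents_eq_card, ← Finset.card_univ, ← nsmul_eq_mul]
    exact Finset.sum_le_card_nsmul _ _ _ fun c _ => Nat.cast_le.2 (h3 c)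
  have hexc : M * f ≤ n ^ 2 * graphExcess G := by
    have h : pairSum G ≤ n ^ 2 * graphExcess G :=
      le_excess hn0 (sum_compSize_cast G) fun c _ => (compSize_pos c).le
    have h' := card_mul_frag_le G
    rw [← hn, ← hf] at h'
    have : 0 ≤ M * f := mul_nonneg hM0.le hf0
    nlinarith
  have hprod : M * f ≤ k * sizeProd G := by
    set Q : ℝ := ∏ c ∈ Finset.univ.erase c₀, (compSize c : ℝ) with hQ
    have hQ0 : 0 ≤ Q := Finset.prod_nonneg fun c _ => (compSize_pos c).le
    have hle : ∀ c ∈ Finset.univ.erase c₀, (compSize c : ℝ) ≤ Q := by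
      intro c hc
      have := Finset.single_le_prod' (f := fun c : G.ConnectedComponent => compSize c)
        (fun d _ => one_le_compSize d) hc
      rw [hQ]
      exact_mod_cast this
    have hfQ : f ≤ k * Q := by
      rw [← h2]
      refine (Finset.sum_le_card_nsmul _ _ _ hle).trans ?_
      rw [nsmul_eq_mul]
      refine mul_le_mul_of_nonneg_right ?_ hQ0
      rw [hk, numComponents_eq_card]
      exact_mod_cast Finset.card_le_univ _
    rw [sizeProd, ← Finset.mul_prod_erase _ _ (Finset.mem_univ c₀), ← hQ, ← hM]
    calc M * f ≤ M * (k * Q) := mul_le_mul_of_nonneg_left hfQ hM0.le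
      _ = k * (M * Q) := by ring
  refine le_of_mul_le_mul_left ?_ (pow_pos hn0 2)
  calc n ^ 2 * f ^ 2 ≤ (k * M) ^ 2 * f ^ 2 :=
        mul_le_mul_of_nonneg_right (pow_le_pow_left₀ hn0.le hkM 2) (sq_nonneg f)
    _ = k ^ 2 * ((M * f) * (M * f)) := by ring
    _ ≤ k ^ 2 * ((k * sizeProd G) * (n ^ 2 * graphExcess G)) := by
        refine mul_le_mul_of_nonneg_left ?_ (sq_nonneg k)
        exact mul_le_mul hprod hexc (mul_nonneg hM0.le hf0)
          (mul_nonneg hk0.le (sizeProd_pos G).le)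
    _ = n ^ 2 * (k ^ 3 * (sizeProd G * graphExcess G)) := by ring

end Frag

/-! ### The fragment in a bridge class -/

section ClassBound

variable {V : Type*} [Fintype V]

lemma sum_pow_mul_pairSum (H : SimpleGraph V) (x : ℝ) :
    ∑ G ∈ bridgeClass H, x ^ numComponents G * pairSum G =
      2 * (x * ∑ G ∈ bridgeClass H, x ^ numComponents G * (bridges G).ncard) := by
  have h := sum_cross_eq_sum_bridges H (fun G => x ^ (numComponents G + 1))
  calc ∑ G ∈ bridgeClass H, x ^ numComponents G * pairSum G
      = ∑ G ∈ bridgeClass H, ∑ p : V × V with ¬ G.Reachable p.1 p.2,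
          x ^ (numComponents (G ⊔ edge p.1 p.2) + 1) := by
        refine Finset.sum_congr rfl fun G _ => ?_
        rw [← card_cross, mul_comm, ← nsmul_eq_mul, ← Finset.sum_const]
        exact Finset.sum_congr rfl fun p hp => by
          rw [numComponents_sup_edge (Finset.mem_filter.1 hp).2]
    _ = _ := by
        rw [h, Finset.mul_sum, Finset.mul_sum]
        refine Finset.sum_congr rfl fun G _ => ?_
        rw [nsmul_eq_mul]
        push_cast
        ring

lemma add_two_pow_three_le (i : ℕ) : ((i : ℝ) + 2) ^ 3 ≤ 8 * 8 ^ i := by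
  have h : ((i : ℝ) + 2) ≤ 2 * 2 ^ i := by
    have : i + 2 ≤ 2 * 2 ^ i := by
      have := Nat.lt_two_pow_self (n := i + 1)
      rw [pow_succ] at this
      omega
    exact_mod_cast this
  calc ((i : ℝ) + 2) ^ 3 ≤ (2 * 2 ^ i) ^ 3 := pow_le_pow_left₀ (by positivity) h 3
    _ = 8 * 8 ^ i := by
      rw [mul_pow, ← pow_mul, mul_comm i 3, pow_mul]; norm_num

/-- The second moment of the fragment in a bridge class is `O(√n)`, uniformly in the class. -/
lemma sum_pow_mul_frag_sq_le [Nonempty V] (H : SimpleGraph V) {x : ℝ} (hx : 0 < x) :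
    ∑ G ∈ bridgeClass H, x ^ numComponents G * (frag G : ℝ) ^ 2 ≤
      16 * x * Real.exp (8 * x) * √(Fintype.card V) *
        ∑ G ∈ bridgeClass H, x ^ numComponents G := by
  set W := ∑ G ∈ bridgeClass H, x ^ numComponents G with hW
  set Z := levelSum H 1 (fun _ => 1) with hZ
  set h := graphExcess H with hh
  have hZ0 : 0 ≤ Z := levelSum_nonneg fun _ => zero_le_one
  have hh0 : 0 ≤ h := graphExcess_nonneg H
  have hZW : x * Z ≤ W := by
    rw [hZ, levelSum, Finset.mul_sum, hW]
    refine (Finset.sum_le_sum fun G hG => ?_).trans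
      (Finset.sum_le_sum_of_subset_of_nonneg (Finset.filter_subset _ _) fun G _ _ => ?_)
    · rw [(Finset.mem_filter.1 hG).2]; simp
    · positivity
  obtain ⟨m, hm⟩ : ∃ m, numComponents H = m + 1 :=
    ⟨numComponents H - 1, by have := numComponents_pos H; omega⟩
  have hlevels : ∑ G ∈ bridgeClass H, x ^ numComponents G * (frag G : ℝ) ^ 2 =
      ∑ k ∈ Finset.range (m + 2),
        levelSum H k (fun G => x ^ numComponents G * (frag G : ℝ) ^ 2) := by
    refine (Finset.sum_fiberwise_of_maps_to (fun G hG => Finset.mem_range.2 ?_) _).symm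
    have := ncard_bridges_add_numComponents G
    rw [mem_bridgeClass.1 hG] at this
    omega
  have hzero : ∀ k ≤ 1, levelSum H k (fun G => x ^ numComponents G * (frag G : ℝ) ^ 2) = 0 := by
    intro k hk
    refine Finset.sum_eq_zero fun G hG => ?_
    rw [frag_eq_zero_of_numComponents_le_one ((Finset.mem_filter.1 hG).2.trans_le hk)]
    simp
  have hlevel : ∀ i ∈ Finset.range m,
      levelSum H (i + 2) (fun G => x ^ numComponents G * (frag G : ℝ) ^ 2) ≤
        8 * x * (h * (x * Z)) * ((8 * x) ^ i / i.factorial) := by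
    intro i hi
    have hi : i + 2 ≤ numComponents H := by have := Finset.mem_range.1 hi; omega
    calc levelSum H (i + 2) (fun G => x ^ numComponents G * (frag G : ℝ) ^ 2)
        ≤ levelSum H (i + 2)
            (fun G => (x ^ (i + 2) * ((i : ℝ) + 2) ^ 3) * (sizeProd G * graphExcess G)) := by
          refine Finset.sum_le_sum fun G hG => ?_
          have := frag_sq_le G
          rw [(Finset.mem_filter.1 hG).2] at this ⊢
          push_cast at this
          rw [mul_assoc]
          exact mul_le_mul_of_nonneg_left this (by positivity)
      _ ≤ (x ^ (i + 2) * (8 * 8 ^ i)) * (h * Z / i.factorial) := by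
          rw [levelSum_const_mul]
          refine mul_le_mul (mul_le_mul_of_nonneg_left (add_two_pow_three_le i) (by positivity))
            (levelSum_sizeProd_mul_graphExcess_le H hi) ?_ (by positivity)
          exact levelSum_nonneg fun G => mul_nonneg (sizeProd_pos G).le (graphExcess_nonneg G)
      _ = 8 * x * (h * (x * Z)) * ((8 * x) ^ i / i.factorial) := by
          rw [mul_pow, pow_add]; ring
  rw [hlevels, Finset.sum_range_succ', Finset.sum_range_succ', hzero 0 (by norm_num),
    hzero (0 + 1) (by norm_num), add_zero, add_zero]
  have hxZ : 0 ≤ x * Z := mul_nonneg hx.le hZ0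
  calc _ ≤ ∑ i ∈ Finset.range m, 8 * x * (h * (x * Z)) * ((8 * x) ^ i / i.factorial) :=
        Finset.sum_le_sum hlevel
    _ ≤ 8 * x * (h * (x * Z)) * Real.exp (8 * x) := by
        rw [← Finset.mul_sum]
        exact mul_le_mul_of_nonneg_left (Real.sum_le_exp_of_nonneg (by positivity) m)
          (by positivity)
    _ ≤ 8 * x * ((2 * √(Fintype.card V)) * W) * Real.exp (8 * x) := by
        have := mul_le_mul (graphExcess_le H) hZW hxZ (by positivity)
        gcongr
    _ = _ := by ring

/-- The mean of the fragment in a bridge class: there are at most `n` bridges, so on average at most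
`x * n` cross edges, of which at least `frag * (n - frag)` leave a largest component. -/
lemma sum_pow_mul_frag_le [Nonempty V] (H : SimpleGraph V) {x : ℝ} (hx : 0 < x) :
    ∑ G ∈ bridgeClass H, x ^ numComponents G * (frag G : ℝ) ≤
      (x + 16 * x * Real.exp (8 * x) / √(Fintype.card V)) *
        ∑ G ∈ bridgeClass H, x ^ numComponents G := by
  have hn : (0 : ℝ) < Fintype.card V := Nat.cast_pos.2 Fintype.card_pos
  have h1 := sum_pow_mul_frag_sq_le H hx
  have h2 := sum_pow_mul_pairSum H x
  have h3 : ∑ G ∈ bridgeClass H, x ^ numComponents G * ((bridges G).ncard : ℝ) ≤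
      Fintype.card V * ∑ G ∈ bridgeClass H, x ^ numComponents G := by
    rw [Finset.mul_sum]
    refine Finset.sum_le_sum fun G _ => ?_
    rw [mul_comm]
    refine mul_le_mul_of_nonneg_right ?_ (by positivity)
    have := ncard_bridges_add_numComponents G
    have := numComponents_le_card (removeBridges G)
    exact_mod_cast (by omega : (bridges G).ncard ≤ Fintype.card V)
  have h4 : Fintype.card V * ∑ G ∈ bridgeClass H, x ^ numComponents G * (frag G : ℝ) ≤
      (∑ G ∈ bridgeClass H, x ^ numComponents G * pairSum G) / 2 +
        ∑ G ∈ bridgeClass H, x ^ numComponents G * (frag G : ℝ) ^ 2 := by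
    rw [Finset.mul_sum, Finset.sum_div, ← Finset.sum_add_distrib]
    refine Finset.sum_le_sum fun G _ => ?_
    have := mul_le_mul_of_nonneg_left (card_mul_frag_le G) (pow_pos hx (numComponents G)).le
    linarith
  set W := ∑ G ∈ bridgeClass H, x ^ numComponents G
  have h5 := mul_le_mul_of_nonneg_left h3 hx.le
  refine le_of_mul_le_mul_left (h4.trans ?_) hn
  have h6 : (Fintype.card V : ℝ) * ((x + 16 * x * Real.exp (8 * x) / √(Fintype.card V)) * W) =
      x * (Fintype.card V * W) + 16 * x * Real.exp (8 * x) * √(Fintype.card V) * W := by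
    have hs : (Fintype.card V : ℝ) / √(Fintype.card V) = √(Fintype.card V) := Real.div_sqrt
    calc _ = x * (Fintype.card V * W) + 16 * x * Real.exp (8 * x) *
          ((Fintype.card V : ℝ) / √(Fintype.card V)) * W := by ring
      _ = _ := by rw [hs]
  rw [h6]
  linarith

end ClassBound

/-! ### Weighted random graphs -/

section Weighted

lemma BridgeAlterable.removeBridges_mem_iff {A : GraphSet} (hA : BridgeAlterable A) {n : ℕ}
    (G : SimpleGraph (Fin n)) : removeBridges G ∈ A n ↔ G ∈ A n := by
  induction G using bridge_induction with
  | base G h => rw [removeBridges_eq_self h]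
  | step G u v h ih =>
    rw [removeBridges_sup_edge h, ih]
    refine ⟨fun hG => hA.1 n G hG u v h, fun hG => ?_⟩
    have := hA.2 n _ hG s(u, v) (by rw [bridges_sup_edge h]; exact Set.mem_insert _ _)
    rwa [deleteEdges_sup_edge h] at this

/-- Within a bridge class `e₀ + κ` is constant, so the weight is proportional to `(ν / λ) ^ κ`. -/
lemma Weighting.weight_eq (τ : Weighting) {n : ℕ} (G : SimpleGraph (Fin n)) :
    τ.weight G = τ.f n (removeBridges G) * τ.lam ^ numComponents (removeBridges G) *
      (τ.nu / τ.lam) ^ numComponents G := by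
  have := pow_pos τ.lam_pos (numComponents G)
  rw [Weighting.weight, ← ncard_bridges_add_numComponents G, pow_add, div_pow]
  field_simp

lemma sum_eq_sum_bridgeClass {A : GraphSet} (hA : BridgeAlterable A) {n : ℕ}
    (F : SimpleGraph (Fin n) → ℝ) :
    ∑ G with G ∈ A n, F G = ∑ H with H ∈ A n, ∑ G ∈ bridgeClass H, F G := by
  rw [← Finset.sum_fiberwise_of_maps_to (g := removeBridges)
    (t := Finset.univ.filter (· ∈ A n))]
  · refine Finset.sum_congr rfl fun H hH => Finset.sum_congr ?_ fun _ _ => rfl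
    ext G
    have hH := (Finset.mem_filter.1 hH).2
    simp only [Finset.mem_filter, Finset.mem_univ, true_and, mem_bridgeClass,
      and_iff_right_iff_imp]
    rintro rfl
    exact (hA.removeBridges_mem_iff G).1 hH
  · intro G hG
    simp only [Finset.mem_filter, Finset.mem_univ, true_and] at hG ⊢
    exact (hA.removeBridges_mem_iff G).2 hG

lemma sum_weight_mul_frag_le {A : GraphSet} (hA : BridgeAlterable A) (τ : Weighting) {n : ℕ}
    (hn : 0 < n) :
    ∑ G with G ∈ A n, τ.weight G * (frag G : ℝ) ≤
      (τ.nu / τ.lam + 16 * (τ.nu / τ.lam) * Real.exp (8 * (τ.nu / τ.lam)) / √n) *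
        τ.total (A n) := by
  have : Nonempty (Fin n) := ⟨⟨0, hn⟩⟩
  rw [Weighting.total, sum_eq_sum_bridgeClass hA τ.weight,
    sum_eq_sum_bridgeClass hA fun G => τ.weight G * (frag G : ℝ), Finset.mul_sum]
  refine Finset.sum_le_sum fun H _ => ?_
  rcases (bridgeClass H).eq_empty_or_nonempty with h | ⟨G₀, hG₀⟩
  · simp [h]
  have hf : 0 ≤ τ.f n H * τ.lam ^ numComponents H :=
    mul_nonneg (τ.f_nonneg n H (by rw [← mem_bridgeClass.1 hG₀, bridges_removeBridges]))
      (pow_pos τ.lam_pos _).le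
  have hw : ∀ G ∈ bridgeClass H, τ.weight G =
      τ.f n H * τ.lam ^ numComponents H * (τ.nu / τ.lam) ^ numComponents G := by
    intro G hG
    rw [τ.weight_eq, mem_bridgeClass.1 hG]
  have h := mul_le_mul_of_nonneg_left
    (sum_pow_mul_frag_le H (div_pos τ.nu_pos τ.lam_pos)) hf
  rw [Fintype.card_fin] at h
  rw [Finset.sum_congr rfl hw, ← Finset.mul_sum,
    Finset.sum_congr rfl fun G hG => by rw [hw G hG, mul_assoc], ← Finset.mul_sum]
  linarith

lemma measurableSet_graph_singleton {n : ℕ} (G : SimpleGraph (Fin n)) :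
    MeasurableSet ({G} : Set (SimpleGraph (Fin n))) := by
  have h := SimpleGraph.measurableEmbedding_edgeSet (V := Fin n)
  have h1 : ({G} : Set (SimpleGraph (Fin n))) = SimpleGraph.edgeSet ⁻¹' {G.edgeSet} := by
    ext G'
    simp
  rw [h1]
  exact h.measurable (measurableSet_singleton _)

/-- Graphs outside `B` do not contribute, since the probabilities inside add up to `1`. -/
lemma expectedFrag_eq_sum {n : ℕ} {B : Set (SimpleGraph (Fin n))} {Ω : Type*} [MeasurableSpace Ω]
    {P : Measure Ω} [IsProbabilityMeasure P] {R : Ω → SimpleGraph (Fin n)} (hR : Measurable R)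
    {w : SimpleGraph (Fin n) → ℝ} (hw : ∀ G ∈ B, P.real {ω | R ω = G} = w G)
    (hsum : ∑ G with G ∈ B, w G = 1) :
    expectedFrag P R = ∑ G with G ∈ B, w G * (frag G : ℝ) := by
  have : MeasurableSingletonClass (SimpleGraph (Fin n)) := ⟨measurableSet_graph_singleton⟩
  have : IsProbabilityMeasure (P.map R) := Measure.isProbabilityMeasure_map hR.aemeasurable
  have hreal : ∀ G, (P.map R).real {G} = P.real {ω | R ω = G} := by
    intro G
    rw [map_measureReal_apply hR (measurableSet_singleton G)]
    rfl
  have htot : ∑ G, (P.map R).real {G} = 1 := by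
    rw [sum_measureReal_singleton, Finset.coe_univ, probReal_univ]
  have hin : ∑ G with G ∈ B, (P.map R).real {G} = 1 := by
    rw [← hsum]
    exact Finset.sum_congr rfl fun G hG => by rw [hreal, hw G (Finset.mem_filter.1 hG).2]
  have hout : ∀ G, G ∉ B → (P.map R).real {G} = 0 := by
    rw [← Finset.sum_filter_add_sum_filter_not Finset.univ (· ∈ B), hin, add_eq_left,
      Finset.sum_eq_zero_iff_of_nonneg fun _ _ => measureReal_nonneg] at htot
    exact fun G hG => htot G (by simpa using hG)
  have hmeas : Measurable fun G : SimpleGraph (Fin n) => (frag G : ℝ) := measurable_of_finite _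
  rw [expectedFrag, ← integral_map (f := fun G : SimpleGraph (Fin n) => (frag G : ℝ))
    hR.aemeasurable hmeas.aestronglyMeasurable, integral_fintype (.of_finite), Finset.sum_filter]
  refine Finset.sum_congr rfl fun G _ => ?_
  split_ifs with hG
  · rw [hreal, hw G hG, smul_eq_mul]
  · rw [hout G hG, zero_smul]

lemma IsWeightedRandom.expectedFrag_eq {τ : Weighting} {n : ℕ} {B : Set (SimpleGraph (Fin n))}
    {Ω : Type*} [MeasurableSpace Ω] {P : Measure Ω} [IsProbabilityMeasure P]
    {R : Ω → SimpleGraph (Fin n)} (h : IsWeightedRandom τ B P R) :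
    expectedFrag P R = (∑ G with G ∈ B, τ.weight G * (frag G : ℝ)) / τ.total B := by
  rw [expectedFrag_eq_sum h.measurable h.prob, Finset.sum_div]
  · exact Finset.sum_congr rfl fun G _ => by ring
  · rw [← Finset.sum_div]
    exact div_self h.total_pos.ne'

/-- The weighting giving weight `1` to every graph. -/
noncomputable def unitWeighting : Weighting where
  lam := 1
  nu := 1
  f _ _ := 1
  lam_pos := one_pos
  nu_pos := one_pos
  f_nonneg _ _ _ := zero_le_one

lemma unitWeighting_weight {n : ℕ} (G : SimpleGraph (Fin n)) : unitWeighting.weight G = 1 := by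
  simp [Weighting.weight, unitWeighting]

lemma unitWeighting_total {n : ℕ} (B : Set (SimpleGraph (Fin n))) :
    unitWeighting.total B = B.ncard := by
  rw [Weighting.total, Set.ncard_eq_toFinset_card']
  simp only [unitWeighting_weight, Finset.sum_const, nsmul_one]
  congr 2
  ext G
  simp

lemma IsUniformRandom.isWeightedRandom {n : ℕ} {B : Set (SimpleGraph (Fin n))}
    {Ω : Type*} [MeasurableSpace Ω] {P : Measure Ω}
    {R : Ω → SimpleGraph (Fin n)} (h : IsUniformRandom B P R) :
    IsWeightedRandom unitWeighting B P R where
  measurable := h.measurable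
  total_pos := by
    rw [unitWeighting_total]
    exact Nat.cast_pos.2 ((Set.ncard_pos (Set.toFinite _)).2 h.nonempty)
  prob G hG := by rw [h.prob G hG, unitWeighting_weight, unitWeighting_total]

lemma eventually_expectedFrag_le {Ω : ℕ → Type*} [∀ n, MeasurableSpace (Ω n)]
    {P : ∀ n, Measure (Ω n)} [∀ n, IsProbabilityMeasure (P n)]
    {R : ∀ n, Ω n → SimpleGraph (Fin n)} {A : GraphSet} (hA : BridgeAlterable A) {τ : Weighting}
    (h : ∀ᶠ n in atTop, IsWeightedRandom τ (A n) (P n) (R n)) :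
    ∀ᶠ n : ℕ in atTop, expectedFrag (P n) (R n) ≤
      τ.nu / τ.lam + 16 * (τ.nu / τ.lam) * Real.exp (8 * (τ.nu / τ.lam)) / √n := by
  filter_upwards [h, eventually_gt_atTop 0] with n hn hn0
  rw [hn.expectedFrag_eq, div_le_iff₀ hn.total_pos]
  exact sum_weight_mul_frag_le hA τ hn0

lemma tendsto_add_div_sqrt (a b : ℝ) : Tendsto (fun n : ℕ => a + b / √n) atTop (𝓝 a) := by
  have h : Tendsto (fun n : ℕ => √(n : ℝ)) atTop atTop :=
    Real.tendsto_sqrt_atTop.comp tendsto_natCast_atTop_atTop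
  simpa using (tendsto_const_nhds (x := a)).add (h.const_div_atTop b)

lemma limsup_expectedFrag_le {Ω : ℕ → Type*} [∀ n, MeasurableSpace (Ω n)]
    {P : ∀ n, Measure (Ω n)} [∀ n, IsProbabilityMeasure (P n)]
    {R : ∀ n, Ω n → SimpleGraph (Fin n)} {A : GraphSet} (hA : BridgeAlterable A) {τ : Weighting}
    (h : ∀ᶠ n in atTop, IsWeightedRandom τ (A n) (P n) (R n)) :
    limsup (fun n => (expectedFrag (P n) (R n) : EReal)) atTop ≤ ((τ.nu / τ.lam : ℝ) : EReal) := by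
  have ht := (continuous_coe_real_ereal.tendsto _).comp (tendsto_add_div_sqrt (τ.nu / τ.lam)
    (16 * (τ.nu / τ.lam) * Real.exp (8 * (τ.nu / τ.lam))))
  rw [← ht.limsup_eq]
  refine limsup_le_limsup ?_
  filter_upwards [eventually_expectedFrag_le hA h] with n hn
  exact EReal.coe_le_coe_iff.2 hn

end Weighted

/-! ### Forests -/

section Forests

lemma bridgeAlterable_forests : BridgeAlterable forests :=
  ⟨fun _ _ hG _ _ h => IsAcyclic.sup_edge_of_not_reachable h hG,
    fun _ _ hG _ _ => IsAcyclic.anti (deleteEdges_le _) hG⟩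

lemma removeBridges_eq_bot_iff {V : Type*} (G : SimpleGraph V) :
    removeBridges G = ⊥ ↔ G.IsAcyclic := by
  rw [removeBridges, deleteEdges_eq_bot, isAcyclic_iff_forall_isBridge]
  exact ⟨fun h e he => (h he).2, fun h e he => ⟨he, h he⟩⟩

lemma numComponents_bot (n : ℕ) : numComponents (⊥ : SimpleGraph (Fin n)) = n := by
  have h : Function.Bijective (⊥ : SimpleGraph (Fin n)).connectedComponentMk :=
    ⟨fun u v h => by simpa using ConnectedComponent.eq.1 h, Quot.mk_surjective⟩
  rw [numComponents, ← Nat.card_congr (Equiv.ofBijective _ h), Nat.card_eq_fintype_card,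
    Fintype.card_fin]

/-- A forest with `k` components has `n - k ≥ n - 1 - frag` edges, all of them bridges, and at most
`n * frag` cross edges; the two counts agree on average. -/
lemma le_sum_frag_forests {n : ℕ} (hn : 0 < n) :
    (n - 1 : ℝ) * (forests n).ncard ≤ (n + 1) * ∑ G with G ∈ forests n, (frag G : ℝ) := by
  have : Nonempty (Fin n) := ⟨⟨0, hn⟩⟩
  have hclass : (Finset.univ.filter (· ∈ forests n)) = bridgeClass ⊥ := by
    ext G
    simp only [Finset.mem_filter, Finset.mem_univ, true_and, mem_bridgeClass,
      removeBridges_eq_bot_iff]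
    rfl
  have hcard : ((forests n).ncard : ℝ) = ∑ G ∈ bridgeClass (⊥ : SimpleGraph (Fin n)), 1 := by
    rw [← unitWeighting_total, Weighting.total, hclass]
    exact Finset.sum_congr rfl fun G _ => unitWeighting_weight G
  have h1 := sum_pow_mul_pairSum (⊥ : SimpleGraph (Fin n)) 1
  simp only [one_pow, one_mul] at h1
  have h2 : ∑ G ∈ bridgeClass (⊥ : SimpleGraph (Fin n)), pairSum G ≤
      2 * (n * ∑ G ∈ bridgeClass (⊥ : SimpleGraph (Fin n)), (frag G : ℝ)) := by
    rw [Finset.mul_sum, Finset.mul_sum]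
    refine Finset.sum_le_sum fun G _ => ?_
    simpa using pairSum_le G
  have h3 : (n - 1 : ℝ) * ∑ G ∈ bridgeClass (⊥ : SimpleGraph (Fin n)), (1 : ℝ) -
      ∑ G ∈ bridgeClass (⊥ : SimpleGraph (Fin n)), (frag G : ℝ) ≤
      ∑ G ∈ bridgeClass (⊥ : SimpleGraph (Fin n)), ((bridges G).ncard : ℝ) := by
    rw [Finset.mul_sum, ← Finset.sum_sub_distrib]
    refine Finset.sum_le_sum fun G hG => ?_
    have h4 := ncard_bridges_add_numComponents G
    rw [mem_bridgeClass.1 hG, numComponents_bot] at h4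
    have h5 : ((bridges G).ncard : ℝ) + numComponents G = n := by exact_mod_cast h4
    linarith [numComponents_le_frag_add_one G]
  rw [hclass, hcard]
  linarith

lemma tendsto_expectedFrag_forests {Ω : ℕ → Type*} [∀ n, MeasurableSpace (Ω n)]
    {P : ∀ n, Measure (Ω n)} [∀ n, IsProbabilityMeasure (P n)]
    {R : ∀ n, Ω n → SimpleGraph (Fin n)}
    (h : ∀ᶠ n in atTop, IsUniformRandom (forests n) (P n) (R n)) :
    Tendsto (fun n => expectedFrag (P n) (R n)) atTop (𝓝 1) := by
  have hw := h.mono fun n hn => hn.isWeightedRandom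
  have hup := eventually_expectedFrag_le bridgeAlterable_forests hw
  have hlow : ∀ᶠ n : ℕ in atTop, 1 - 2 / ((n : ℝ) + 1) ≤ expectedFrag (P n) (R n) := by
    filter_upwards [hw, eventually_gt_atTop 0] with n hn hn0
    have hp := hn.total_pos
    have hf := le_sum_frag_forests hn0
    rw [hn.expectedFrag_eq]
    simp only [unitWeighting_weight, one_mul]
    rw [unitWeighting_total] at hp ⊢
    have hn1 : (0 : ℝ) < n + 1 := by positivity
    rw [le_div_iff₀ hp]
    refine le_of_mul_le_mul_left (le_trans (le_of_eq ?_) hf) hn1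
    field_simp
    ring
  refine tendsto_of_tendsto_of_tendsto_of_le_of_le' ?_ (tendsto_add_div_sqrt 1 _) hlow
    (by simpa [unitWeighting] using hup)
  have : Tendsto (fun n : ℕ => (n : ℝ) + 1) atTop atTop :=
    tendsto_atTop_add_const_right _ _ tendsto_natCast_atTop_atTop
  simpa using (tendsto_const_nhds (x := (1 : ℝ))).sub (this.const_div_atTop 2)

end Forests

end RandomWeightedGraph

open RandomWeightedGraph in
theorem mainTheorem3 {Ω : ℕ → Type*} [∀ n, MeasurableSpace (Ω n)]
    (P : ∀ n, MeasureTheory.Measure (Ω n)) [∀ n, MeasureTheory.IsProbabilityMeasure (P n)]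
    (R : ∀ n, Ω n → SimpleGraph (Fin n)) :
    -- weighted random graphs from a bridge-alterable set
    (∀ (A : RandomWeightedGraph.GraphSet) (τ : RandomWeightedGraph.Weighting),
      RandomWeightedGraph.BridgeAlterable A →
      (∀ᶠ n in atTop, RandomWeightedGraph.IsWeightedRandom τ (A n) (P n) (R n)) →
      limsup (fun n => (RandomWeightedGraph.expectedFrag (P n) (R n) : EReal)) atTop
        ≤ ((τ.nu / τ.lam : ℝ) : EReal)) ∧
    -- uniform random graphs from a bridge-alterable set
    (∀ A : RandomWeightedGraph.GraphSet,
      RandomWeightedGraph.BridgeAlterable A →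
      (∀ᶠ n in atTop, RandomWeightedGraph.IsUniformRandom (A n) (P n) (R n)) →
      limsup (fun n => (RandomWeightedGraph.expectedFrag (P n) (R n) : EReal)) atTop ≤ 1) ∧
    -- the bound 1 is attained by uniform random forests
    (RandomWeightedGraph.BridgeAlterable RandomWeightedGraph.forests ∧
      ((∀ᶠ n in atTop,
          RandomWeightedGraph.IsUniformRandom (RandomWeightedGraph.forests n) (P n) (R n)) →
        Tendsto (fun n => RandomWeightedGraph.expectedFrag (P n) (R n)) atTop (𝓝 1))) := by
  refine ⟨fun A τ hA h => limsup_expectedFrag_le hA h, fun A hA h => ?_, bridgeAlterable_forests,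
    fun h => tendsto_expectedFrag_forests h⟩
  simpa [unitWeighting] using
    limsup_expectedFrag_le hA (h.mono fun n hn => hn.isWeightedRandom)
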